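/- **Model.** For every $n\in\mathbb N_0$ let $X_n$ (states) and $A_n$ (actions) be complete separable metric spaces, $S_n$ a Borel space (a Borel subset of a Polish space), $(\Omega^n,\mathcal G^n,\mathbb P^n)$ an atomless probability space and $\xi_n:\Omega^n\to S_n$ measurable. For $x\in X_n$ let $A_n(x)\subseteq A_n$ be a nonempty set of available actions, $\mathbb K_n=\{(x,a):x\in X_n,\ a\in A_n(x)\}$, let $F_n:\mathbb K_n\times S_n\to X_{n+1}$ be continuous and let $c_n:\mathbb K_n\to[0,\infty)$ be a cost function. Let $\Omega=\prod_i\Omega^i$, $\mathbb P=\bigotimes_i\mathbb P^i$, and let $\mathcal F_n$ be the $\sigma$-algebra generated by the coordinates $\omega_i$, $i<n$. A policy $\pi=(\pi_m)_{m\ge0}$ consists of measurable maps $\pi_m:X_m\to A_m$ with $\pi_m(x)\in A_m(x)$ for all $x$. For a start in $x_n=x$ at time $n$ it yields $a_m=\pi_m(x_m)$, $x_{m+1}=F_m(x_m,a_m,\xi_m)$, $m\ge n$. **Risk mappings.** For every $n$ let $\rho_n:L^1(\Omega,\mathcal F_{n+1},\mathbb P)\to L^1(\Omega,\mathcal F_n,\mathbb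 P)$ be a one-step conditional risk mapping, that is, $\mathbb P$-a.s.: $\rho_n(tX+(1-t)Y)\le t\rho_n(X)+(1-t)\rho_n(Y)$ for $t\in[0,1]$; $\rho_n(X)\le\rho_n(Y)$ if $X\le Y$ a.s.; $\rho_n(X+Y)=\rho_n(X)+Y$ if $Y$ is $\mathcal F_n$-measurable and integrable; $\rho_n(\Lambda X)=\Lambda\rho_n(X)$ if $\Lambda\ge0$ is $\mathcal F_n$-measurable and $\Lambda$, $\Lambda X$ are integrable. Let $\rho_n$ be law invariant: $\rho_n(Z)=R_n(\mathcal L(Z\mid\mathcal F_n))$ a.s. for all $Z$, for a (deterministic) functional $R_n$ of the regular conditional law. For $Z$ with values in $[0,\infty]$ put $\rho_n(Z)=\lim_{k}\rho_n(Z\wedge k)$. Let $\gamma>0$ (in particular, $\gamma$ may be any discount factor in $(0,1)$). **Values.** For $N\ge n$ and $x\in X_n$, with $x_n=x$, let $$V_{n,N}(x,\pi)=c_n(x_n,a_n)+\gamma\rho_n\big(c_{n+1}(x_{n+1},a_{n+1})+\gamma\rho_{n+1}(\cdots+\gamma\rho_{N-1}(c_N(x_N,a_N))\cdots)\big),\qquad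 V_n(x,\pi)=\lim_{N\to\infty}V_{n,N}(x,\pi).$$ The policy $\pi$ is admissible for the start $(n,x)$, $\pi\in\Pi_{\mathrm{ad}}(n,x)$, if for every $m\ge n$ the remaining cost $\lim_{N}\big[c_m(x_m,a_m)+\gamma\rho_m(c_{m+1}(x_{m+1},a_{m+1})+\cdots+\gamma\rho_{N-1}(c_N(x_N,a_N))\cdots)\big]$ is finite $\mathbb P$-a.s. Put $V_n^*(x)=\inf_{\pi\in\Pi_{\mathrm{ad}}(n,x)}V_n(x,\pi)$ and $V_{n,N}^*(x)=\inf_{\pi\in\Pi_{\mathrm{ad}}(n,x)}V_{n,N}(x,\pi)$, with $\inf\emptyset=\infty$. Moreover, let $J_{N+1,N}\equiv0$ and, going backwards in time, $$J_{n,N}(x)=\inf_{a\in A_n(x)}\Big(c_n(x,a)+\gamma\rho_n\big(J_{n+1,N}(F_n(x,a,\xi_n))\big)\Big),\qquad n\le N.$$ **Assumptions.** For every $n$: (1) the transition law $Q_n(\cdot\mid x,a)=\mathbb P^n(F_n(x,a,\xi_n)\in\cdot)$ is weakly continuous in $(x,a)\in\mathbb K_n$; (2) $c_n$ is lower semicontinuous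 on $\mathbb K_n$; the multifunction $x\mapsto A_n(x)$ is upper semicontinuous (for every open $U\supseteq A_n(x)$, $A_n(x')\subseteq U$ for all $x'$ near $x$) and has compact values. **Theorem.** Under these assumptions, for every $n\ge0$ and $x\in X_n$: for every policy $\pi$ the random variables $V_{n,N}(x,\pi)$, $N\ge n$, and $V_n(x,\pi)$ are $\mathbb P$-a.s. constant (so that the infima above are infima of numbers in $[0,\infty]$), and the limit that defines $V_n(x,\pi)$ exists $\mathbb P$-a.s.; $J_{n,N}(x)=\inf_\pi V_{n,N}(x,\pi)$, the infimum over all policies, for all $N\ge n$; and $$J_{n,N}(x)\uparrow V_n^*(x)\quad\text{and}\quad V_{n,N}^*(x)\uparrow V_n^*(x)\qquad(N\to\infty).$$ Moreover, $V_n^*:X_n\to[0,\infty]$ is lower semicontinuous. -/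

import Mathlib

open MeasureTheory ProbabilityTheory Filter Topology
open scoped ENNReal NNReal

noncomputable section

namespace RiskControl

/-- Atomless measure: every measurable set of positive measure splits into two measurable pieces
of positive measure. -/
def IsAtomless {E : Type*} [MeasurableSpace E] (μ : Measure E) : Prop :=
  ∀ s, MeasurableSet s → 0 < μ s → ∃ t, t ⊆ s ∧ MeasurableSet t ∧ 0 < μ t ∧ 0 < μ (s \ t)

/-- The graph `{(x, a) : a ∈ Φ x}` of a multifunction, with the subspace structures. -/
abbrev Graph {X A : Type*} (Φ : X → Set A) : Type _ := {p : X × A // p.2 ∈ Φ p.1}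

/-! ### One-step conditional risk mappings -/

section RiskMappings

variable {E : Type*}

/-- `Z` is (a representative of an element of) `L¹(E, m, P)`, for a sub-`σ`-algebra `m`. -/
def MemZ (m : MeasurableSpace E) {m₀ : MeasurableSpace E} (P : Measure E) (Z : E → ℝ) : Prop :=
  Measurable[m] Z ∧ Integrable Z P

/-- A one-step conditional risk mapping `ρ : L¹(E, m', P) → L¹(E, m, P)`, where `m ≤ m'`:
convex, monotone, translation equivariant and positively homogeneous, where all `m`-measurable
quantities count as constants and all relations hold `P`-almost surely. (Monotonicity implies that
`ρ` respects almost sure equality.) -/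
structure IsCondRiskMapping (m m' : MeasurableSpace E) {m₀ : MeasurableSpace E} (P : Measure E)
    (ρ : (E → ℝ) → (E → ℝ)) : Prop where
  maps_to : ∀ X, MemZ m' P X → MemZ m P (ρ X)
  convex : ∀ X Y, MemZ m' P X → MemZ m' P Y → ∀ t : ℝ, 0 ≤ t → t ≤ 1 →
    ∀ᵐ ω ∂P, ρ (fun ω' => t * X ω' + (1 - t) * Y ω') ω ≤ t * ρ X ω + (1 - t) * ρ Y ω
  mono : ∀ X Y, MemZ m' P X → MemZ m' P Y → (∀ᵐ ω ∂P, X ω ≤ Y ω) → ∀ᵐ ω ∂P, ρ X ω ≤ ρ Y ω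
  translation : ∀ X Y, MemZ m' P X → MemZ m P Y →
    ∀ᵐ ω ∂P, ρ (fun ω' => X ω' + Y ω') ω = ρ X ω + Y ω
  homogeneous : ∀ X L, MemZ m' P X → MemZ m P L → (∀ᵐ ω ∂P, 0 ≤ L ω) →
    MemZ m' P (fun ω' => L ω' * X ω') → ∀ᵐ ω ∂P, ρ (fun ω' => L ω' * X ω') ω = L ω * ρ X ω

/-- Law invariance of a conditional risk mapping, where the information `m` is generated by `H`:
the risk of `Z` is a (deterministic) functional of the regular conditional law of `Z` given `H`. -/
def IsLawInvariant {G : Type*} [MeasurableSpace G] (m' : MeasurableSpace E)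
    {m₀ : MeasurableSpace E} (P : Measure E) [IsFiniteMeasure P] (H : E → G)
    (ρ : (E → ℝ) → (E → ℝ)) : Prop :=
  ∃ R : Measure ℝ → ℝ, ∀ Z, MemZ m' P Z → ∀ᵐ ω ∂P, ρ Z ω = R (condDistrib Z H P (H ω))

/-- The monotone extension of a risk mapping to random variables with values in `[0, ∞]`,
`ρ(Z) = lim_k ρ(Z ∧ k)`; costs are nonnegative but need not be integrable. -/
def extend (ρ : (E → ℝ) → (E → ℝ)) (Z : E → ℝ≥0∞) : E → ℝ≥0∞ :=
  fun ω => ⨆ k : ℕ, ENNReal.ofReal (ρ (fun ω' => (min (Z ω') (k : ℝ≥0∞)).toReal) ω)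

end RiskMappings

/-! ### The controlled Markov chain -/

/-- State spaces `X n`, action spaces `A n`, disturbance spaces `S n` and noise spaces `Ω n`. -/
structure ControlModel (X A S Ω : ℕ → Type*)
    [∀ n, TopologicalSpace (X n)] [∀ n, TopologicalSpace (A n)]
    [∀ n, TopologicalSpace (S n)] [∀ n, MeasurableSpace (S n)]
    [∀ n, MeasurableSpace (Ω n)] where
  /-- the set `A_n(x)` of controls that are available in the state `x` at time `n` -/
  adm : ∀ n, X n → Set (A n)
  adm_nonempty : ∀ n x, (adm n x).Nonempty
  /-- the law of the noise at time `n` -/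
  noise : ∀ n, ProbabilityMeasure (Ω n)
  noise_atomless : ∀ n, IsAtomless (noise n : Measure (Ω n))
  /-- the disturbance at time `n` -/
  ξ : ∀ n, Ω n → S n
  measurable_ξ : ∀ n, Measurable (ξ n)
  /-- the system equation `x_{n+1} = F_n(x_n, a_n, ξ_n)` on feasible state-action pairs -/
  F : ∀ n, Graph (adm n) × S n → X (n + 1)
  continuous_F : ∀ n, Continuous (F n)
  /-- the one-step cost on feasible state-action pairs -/
  c : ∀ n, Graph (adm n) → ℝ≥0

namespace ControlModel

variable {X A S Ω : ℕ → Type*}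
  [∀ n, TopologicalSpace (X n)] [∀ n, TopologicalSpace (A n)]
  [∀ n, TopologicalSpace (S n)] [∀ n, MeasurableSpace (S n)] [∀ n, MeasurableSpace (Ω n)]
  (M : ControlModel X A S Ω)

/-- The probability measure on the space of noise paths: the noises are independent. -/
def prob : Measure (∀ i, Ω i) := Measure.infinitePi fun i => (M.noise i : Measure (Ω i))

instance : IsProbabilityMeasure M.prob := by
  unfold prob; infer_instance

/-- The noises before time `n`. -/
def hist (Ω : ℕ → Type*) (n : ℕ) (ω : ∀ i, Ω i) : ∀ i : Set.Iio n, Ω i := fun i => ω i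

/-- The information at time `n`: the `σ`-algebra generated by the noises before time `n`.
The state at time `n` is measurable with respect to it, the disturbance `ξ n` is independent
of it. -/
abbrev filt (Ω : ℕ → Type*) [∀ n, MeasurableSpace (Ω n)] (n : ℕ) : MeasurableSpace (∀ i, Ω i) :=
  MeasurableSpace.comap (hist Ω n) inferInstance

/-- `ρ n : L¹(filt (n + 1)) → L¹(filt n)` is a law invariant one-step conditional risk mapping
for every `n`. -/
def IsRiskSystem (ρ : ℕ → ((∀ i, Ω i) → ℝ) → ((∀ i, Ω i) → ℝ)) : Prop :=
  ∀ n, IsCondRiskMapping (filt Ω n) (filt Ω (n + 1)) M.prob (ρ n) ∧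
    IsLawInvariant (filt Ω (n + 1)) M.prob (hist Ω n) (ρ n)

/-- The transition law: the law of `F_n(x, a, ξ_n)`. -/
def transition [∀ n, MeasurableSpace (X n)] (n : ℕ) (p : Graph (M.adm n)) :
    Measure (X (n + 1)) :=
  (M.noise n : Measure (Ω n)).map fun w => M.F n (p, M.ξ n w)

/-- Weak continuity of the transition law. -/
def IsWeaklyContinuous [∀ n, MeasurableSpace (X n)] : Prop :=
  ∀ n, ∀ u : BoundedContinuousFunction (X (n + 1)) ℝ,
    Continuous fun p : Graph (M.adm n) => ∫ y, u y ∂(M.transition n p)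

/-- Lower semicontinuous costs, and an upper semicontinuous compact-valued multifunction of
available controls. -/
structure IsSemicontinuousCompact : Prop where
  lsc_cost : ∀ n, LowerSemicontinuous (M.c n)
  usc_adm : ∀ n, UpperHemicontinuous (M.adm n)
  isCompact_adm : ∀ n x, IsCompact (M.adm n x)

/-- Deterministic Markov policies. -/
structure Policy [∀ n, MeasurableSpace (X n)] [∀ n, MeasurableSpace (A n)] where
  rule : ∀ n, X n → A n
  measurable_rule : ∀ n, Measurable (rule n)
  mem_adm : ∀ n x, rule n x ∈ M.adm n x

section Values

variable [∀ n, MeasurableSpace (X n)] [∀ n, MeasurableSpace (A n)]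

variable {M} in
/-- The feasible pair `(x, π_n(x))`. -/
def Policy.pair (π : M.Policy) (n : ℕ) (x : X n) : Graph (M.adm n) :=
  ⟨(x, π.rule n x), π.mem_adm n x⟩

/-- The state at time `n + j` under the policy `π`, when the state at time `n` is `x`. -/
def state (π : M.Policy) {n : ℕ} (x : X n) : (j : ℕ) → (∀ i, Ω i) → X (n + j)
  | 0, _ => x
  | j + 1, ω => M.F (n + j) (π.pair (n + j) (state π x j ω), M.ξ (n + j) (ω (n + j)))

/-- The cost `c_m(x_m, a_m)` at time `m = n + j`, when the state at time `n` is `x`. -/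
def stageCost (π : M.Policy) {n : ℕ} (x : X n) (j : ℕ) (ω : ∀ i, Ω i) : ℝ≥0∞ :=
  (M.c (n + j) (π.pair (n + j) (M.state π x j ω)) : ℝ≥0∞)

variable (γ : ℝ≥0) (ρ : ℕ → ((∀ i, Ω i) → ℝ) → ((∀ i, Ω i) → ℝ))

/-- With `m = n + j` and `N = n + j + k`, the random variable
`c_m + γ ρ_m (c_{m+1} + γ ρ_{m+1} (c_{m+2} + ⋯ + γ ρ_{N-1} (c_N) ⋯ ))`,
when the state at time `n` is `x`. -/
def nestedCost (π : M.Policy) {n : ℕ} (x : X n) : (k j : ℕ) → (∀ i, Ω i) → ℝ≥0∞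
  | 0, j => M.stageCost π x j
  | k + 1, j => fun ω =>
      M.stageCost π x j ω + γ * extend (ρ (n + j)) (nestedCost π x k (j + 1)) ω

/-- The infinite-horizon random cost from time `n + j` on, the limit of the costs with finite
horizon (they increase almost surely, so that the upper limit is the limit). -/
def totalCost (π : M.Policy) {n : ℕ} (x : X n) (j : ℕ) (ω : ∀ i, Ω i) : ℝ≥0∞ :=
  limsup (fun k => M.nestedCost γ ρ π x k j ω) atTop

/-- The policies that are admissible for the start in `x` at time `n`: at all later times the
remaining infinite-horizon cost is almost surely finite. -/
def admissible {n : ℕ} (x : X n) : Set M.Policy :=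
  {π | ∀ j, ∀ᵐ ω ∂M.prob, M.totalCost γ ρ π x j ω < ∞}

/-- `V_{n,N}(x, π)` for `N = n + k`: the value of the random variable `nestedCost` at time `n`,
which is almost surely constant. -/
def value (π : M.Policy) {n : ℕ} (x : X n) (k : ℕ) : ℝ≥0∞ :=
  essSup (M.nestedCost γ ρ π x k 0) M.prob

/-- `V_n(x, π)`: the value of the almost surely constant random variable `totalCost` at time
`n`. -/
def valueInf (π : M.Policy) {n : ℕ} (x : X n) : ℝ≥0∞ :=
  essSup (M.totalCost γ ρ π x 0) M.prob

/-- `V*_{n,N}(x)` for `N = n + k`. -/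
def optValue (n k : ℕ) (x : X n) : ℝ≥0∞ :=
  ⨅ π ∈ M.admissible γ ρ x, M.value γ ρ π x k

/-- `V*_n(x)`. -/
def optValueInf (n : ℕ) (x : X n) : ℝ≥0∞ :=
  ⨅ π ∈ M.admissible γ ρ x, M.valueInf γ ρ π x

/-- Backward dynamic programming: `bellman k n` is the function `J_n` on `X n` that results from
the terminal function `J_{n+k} = 0` by `k` steps
`J_m(x) = inf_a (c_m(x, a) + γ ρ_m (J_{m+1}(F_m(x, a, ξ_m))))`, `a ∈ A_m(x)`. -/
def bellman : (k n : ℕ) → X n → ℝ≥0∞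
  | 0, _, _ => 0
  | k + 1, n, x => ⨅ a : M.adm n x,
      ((M.c n ⟨(x, a), a.2⟩ : ℝ≥0∞) + γ * essSup (extend (ρ n) fun ω =>
        bellman k (n + 1) (M.F n (⟨(x, a), a.2⟩, M.ξ n (ω n)))) M.prob)

end Values

end ControlModel

end RiskControl

end

/-!
A law invariant conditional risk mapping is, in a Markovian model with independent noises, a static
risk functional with the history frozen: the conditional law, given the past, of a function of the
past and of the present noise is the law of that function of the noise, for the observed past. So
for every time `n` there is a functional `T n` on `L¹` of the noise space, which is a law invariant
coherent risk measure and represents `ρ n` (`ControlModel.exists_frozenRisk`). The nested costs of a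
policy are then almost surely functions of the present state that satisfy a deterministic backward
recursion (`ControlModel.nestedCost_ae_eq`), in particular they are constants at the initial time.

Three properties of these functionals `T` carry the proof.
* A finite coherent risk functional on `L¹` is Lipschitz continuous, since otherwise it would be
  infinite at a suitable convergent series (`IsCoherentRisk.exists_lipschitz`). Its extension to
  functions with values in `[0, ∞]` is therefore continuous from below and satisfies Fatou's lemma
  (`IsCoherentRisk.extendRisk_iSup`, `IsCoherentRisk.extendRisk_le_liminf`).
* As `L¹` over the disturbance space is separable, risks depend measurably on parameters
  (`IsCoherentRisk.measurable_parameter`), so that the recursion stays within measurable functions.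
* On an atomless space an event of positive probability has positive risk
  (`IsCoherentRisk.indicator_pos`): by Sierpiński's theorem it contains one of `m` events of
  probability `1 / m` that make up the space, and these have equal risks with sum at least `1`.
  Hence a finite risk forces almost sure finiteness (`IsCoherentRisk.ae_lt_top_of_extendRisk`).

As the system functions are continuous, Fatou's lemma makes the one-step cost of a feasible pair
lower semicontinuous if the continuation value is so. Berge's theorem and measurable selection over
compact sets (`lowerSemicontinuous_iInf_inter`, `exists_measurable_selector_le`) then show that the
iterates `bellman` are lower semicontinuous and are attained by Markov policies. Their increasing
limit satisfies the optimality inequality along some policy, because minimization over compact sets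
commutes with increasing limits (`exists_forall_le_iSup_iInf`). The cost of this policy is at most
that limit. If the limit is finite at the initial state, then it is almost surely finite at all
later states, by the third property and `0 < γ`, so that the policy is admissible
(`ControlModel.mem_admissible`). Hence the limit is the optimal value with infinite horizon, and the
finite horizon infima over admissible policies are squeezed between `bellman` and this value.
-/

namespace RiskControl

/-! ### Atomless measures -/

section Atomless

variable {E : Type*} [MeasurableSpace E] {μ : Measure E}

/-- An atomless measure takes arbitrarily small positive values on the subsets of a set of
positive measure: halve repeatedly. -/
theorem IsAtomless.exists_small [IsFiniteMeasure μ] (hμ : IsAtomless μ) {s : Set E}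
    (hs : MeasurableSet s) (hpos : 0 < μ s) {ε : ℝ≥0∞} (hε : 0 < ε) :
    ∃ t, t ⊆ s ∧ MeasurableSet t ∧ 0 < μ t ∧ μ t ≤ ε := by
  have key : ∀ k : ℕ, ∃ t, t ⊆ s ∧ MeasurableSet t ∧ 0 < μ t ∧ μ t ≤ μ s * 2⁻¹ ^ k := by
    intro k
    induction k with
    | zero => exact ⟨s, subset_rfl, hs, hpos, by simp⟩
    | succ k ih =>
      obtain ⟨t, hts, ht, htpos, hle⟩ := ih
      obtain ⟨u, hut, hu, h1, h2⟩ := hμ t ht htpos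
      have hadd : μ u + μ (t \ u) = μ t := by
        rw [← measure_union Set.disjoint_sdiff_right (ht.diff hu), Set.union_sdiff_cancel hut]
      have half : ∀ v, 2 * μ v ≤ μ t → μ v ≤ μ s * 2⁻¹ ^ (k + 1) := by
        intro v hv
        calc μ v = 2⁻¹ * (2 * μ v) := by
              rw [← mul_assoc, ENNReal.inv_mul_cancel (by simp) (by simp), one_mul]
          _ ≤ 2⁻¹ * (μ s * 2⁻¹ ^ k) := mul_le_mul' le_rfl (hv.trans hle)
          _ = μ s * 2⁻¹ ^ (k + 1) := by ring
      rcases le_total (μ u) (μ (t \ u)) with h | h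
      · exact ⟨u, hut.trans hts, hu, h1, half u (by rw [two_mul, ← hadd]; gcongr)⟩
      · exact ⟨t \ u, Set.sdiff_subset.trans hts, ht.diff hu, h2,
          half _ (by rw [two_mul, ← hadd]; gcongr)⟩
  have hlim : Tendsto (fun k : ℕ => μ s * (2⁻¹ : ℝ≥0∞) ^ k) atTop (𝓝 0) := by
    have := ENNReal.Tendsto.const_mul (a := μ s)
      (ENNReal.tendsto_pow_atTop_nhds_zero_of_lt_one (r := 2⁻¹) (by simp))
      (Or.inr (measure_ne_top μ s))
    simpa using this
  obtain ⟨k, hk⟩ := (hlim.eventually_lt_const hε).exists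
  obtain ⟨t, h1, h2, h3, h4⟩ := key k
  exact ⟨t, h1, h2, h3, h4.trans hk.le⟩

/-- Sierpiński's theorem: an atomless finite measure attains on the subsets of `s` all the values
between `0` and `μ s`. -/
theorem IsAtomless.exists_measure_eq [IsFiniteMeasure μ] (hμ : IsAtomless μ) {s : Set E}
    (hs : MeasurableSet s) {c : ℝ≥0∞} (hc : c ≤ μ s) :
    ∃ t, t ⊆ s ∧ MeasurableSet t ∧ μ t = c := by
  classical
  -- Greedily add to `u` a subset of `s \ u` that has at least half of the largest measure that
  -- keeps the total at most `c`.
  let cand : Set E → Set (Set E) := fun u => {v | v ⊆ s \ u ∧ MeasurableSet v ∧ μ u + μ v ≤ c}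
  let top : Set E → ℝ≥0∞ := fun u => ⨆ v ∈ cand u, μ v
  have step : ∀ u, MeasurableSet u → u ⊆ s → μ u ≤ c →
      ∃ v ∈ cand u, top u ≤ 2 * μ v := by
    intro u hu hus huc
    by_cases h0 : top u = 0
    · exact ⟨∅, ⟨by simp, MeasurableSet.empty, by simpa using huc⟩, by simp [h0]⟩
    · have hfin : top u ≠ ∞ := by
        refine ne_top_of_le_ne_top (measure_ne_top μ s) (iSup₂_le fun v hv => ?_)
        exact measure_mono (hv.1.trans Set.sdiff_subset)
      have hlt : top u / 2 < top u := ENNReal.half_lt_self h0 hfin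
      obtain ⟨v, hv⟩ := lt_iSup_iff.1 hlt
      obtain ⟨hvc, hv⟩ := lt_iSup_iff.1 hv
      refine ⟨v, hvc, ?_⟩
      have := (ENNReal.div_le_iff_le_mul (Or.inl two_ne_zero) (Or.inl (by simp))).1 hv.le
      rwa [mul_comm]
  choose! g hg1 hg2 using step
  let u : ℕ → Set E := fun k => Nat.rec ∅ (fun _ w => w ∪ g w) k
  have hu : ∀ k, MeasurableSet (u k) ∧ u k ⊆ s ∧ μ (u k) ≤ c := by
    intro k
    induction k with
    | zero => exact ⟨MeasurableSet.empty, by simp [u], by simp [u]⟩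
    | succ k ih =>
      obtain ⟨h1, h2, h3⟩ := ih
      have := hg1 _ h1 h2 h3
      refine ⟨h1.union this.2.1, Set.union_subset h2 (this.1.trans Set.sdiff_subset), ?_⟩
      exact (measure_union_le _ _).trans this.2.2
  have hg : ∀ k, g (u k) ∈ cand (u k) := fun k => hg1 _ (hu k).1 (hu k).2.1 (hu k).2.2
  have hmono : Monotone u := monotone_nat_of_le_succ fun k => Set.subset_union_left
  have hμu : ∀ k, μ (u (k + 1)) = μ (u k) + μ (g (u k)) := fun k =>
    measure_union (Set.disjoint_sdiff_right.mono_right (hg k).1) (hg k).2.1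
  have hUlim : Tendsto (fun k => μ (u k)) atTop (𝓝 (μ (⋃ k, u k))) :=
    tendsto_measure_iUnion_atTop hmono
  have hUc : μ (⋃ k, u k) ≤ c := le_of_tendsto' hUlim fun k => (hu k).2.2
  have hUm : MeasurableSet (⋃ k, u k) := MeasurableSet.iUnion fun k => (hu k).1
  have hUs : (⋃ k, u k) ⊆ s := Set.iUnion_subset fun k => (hu k).2.1
  refine ⟨⋃ k, u k, hUs, hUm, le_antisymm hUc ?_⟩
  by_contra hlt
  rw [not_le] at hlt
  have hrest : 0 < μ (s \ ⋃ k, u k) := by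
    rw [measure_sdiff hUs hUm.nullMeasurableSet (measure_ne_top _ _)]
    exact tsub_pos_of_lt (hlt.trans_le hc)
  obtain ⟨t, hts, ht, htpos, htle⟩ := hμ.exists_small (hs.diff hUm) hrest (tsub_pos_of_lt hlt)
  -- The set `t` remains a candidate forever, so that the increments do not tend to zero.
  have hinc : ∀ k, μ t ≤ 2 * μ (g (u k)) := by
    intro k
    refine le_trans ?_ (hg2 _ (hu k).1 (hu k).2.1 (hu k).2.2)
    refine le_iSup₂_of_le t ⟨hts.trans (Set.sdiff_subset_sdiff_right (Set.subset_iUnion u k)), ht, ?_⟩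
      le_rfl
    calc μ (u k) + μ t ≤ μ (⋃ k, u k) + (c - μ (⋃ k, u k)) := by
          gcongr
          exact Set.subset_iUnion u k
      _ = c := add_tsub_cancel_of_le hUc
  have hgrow : ∀ k : ℕ, (k : ℝ≥0∞) * μ t ≤ 2 * μ (u k) := by
    intro k
    induction k with
    | zero => simp
    | succ k ih =>
      rw [hμu, mul_add]
      push_cast
      rw [add_mul, one_mul]
      exact add_le_add ih (hinc k)
  have hbdd : ∀ k : ℕ, (k : ℝ≥0∞) ≤ 2 * μ s / μ t := by
    intro k
    rw [ENNReal.le_div_iff_mul_le (Or.inl htpos.ne') (Or.inl (measure_ne_top _ _))]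
    exact (hgrow k).trans (by gcongr; exact (hu k).2.1)
  have htop : 2 * μ s / μ t ≠ ∞ :=
    ENNReal.div_ne_top (ENNReal.mul_ne_top (by simp) (measure_ne_top _ _)) htpos.ne'
  obtain ⟨k, hk⟩ := ENNReal.exists_nat_gt htop
  exact absurd hk (not_lt.2 (hbdd k))

end Atomless

/-! ### Law invariant coherent risk functionals -/

/-- A (static) law invariant coherent risk functional on the integrable random variables of a
probability space. It is defined on functions and meaningful for measurable integrable ones; from
translation equivariance only the value at the constant `1` is kept. -/
structure IsCoherentRisk {E : Type*} [MeasurableSpace E] (μ : Measure E) (T : (E → ℝ) → ℝ) :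
    Prop where
  mono : ∀ f g, Measurable f → Integrable f μ → Measurable g → Integrable g μ →
    (∀ᵐ x ∂μ, f x ≤ g x) → T f ≤ T g
  add_le : ∀ f g, Measurable f → Integrable f μ → Measurable g → Integrable g μ →
    T (fun x => f x + g x) ≤ T f + T g
  const_mul : ∀ f, Measurable f → Integrable f μ → ∀ c : ℝ, 0 ≤ c →
    T (fun x => c * f x) = c * T f
  one : T (fun _ => 1) = 1
  law : ∀ f g, Measurable f → Integrable f μ → Measurable g → Integrable g μ →
    μ.map f = μ.map g → T f = T g

namespace IsCoherentRisk

variable {E : Type*} [MeasurableSpace E] {μ : Measure E} [IsProbabilityMeasure μ]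
  {T : (E → ℝ) → ℝ}

theorem zero (hT : IsCoherentRisk μ T) : T (fun _ => 0) = 0 := by
  simpa using hT.const_mul (fun _ => 1) measurable_const (integrable_const _) 0 le_rfl

/-- A finite coherent risk functional is bounded on the positive cone of `L¹`: otherwise it would
be infinite at a suitable convergent series of positive functions. -/
theorem exists_bound (hT : IsCoherentRisk μ T) :
    ∃ C : ℝ, 0 ≤ C ∧ ∀ f, Measurable f → Integrable f μ → (∀ x, 0 ≤ f x) →
      T f ≤ C * ∫ x, f x ∂μ := by
  by_contra! hcon
  choose f hfm hfi hf0 hf using fun k : ℕ => hcon ((4 : ℝ) ^ k) (by positivity)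
  have hI : ∀ k, 0 < ∫ x, f k x ∂μ := by
    intro k
    refine (integral_nonneg (hf0 k)).lt_of_ne' fun h => ?_
    have h0 : f k =ᵐ[μ] 0 := (integral_eq_zero_iff_of_nonneg (hf0 k) (hfi k)).1 h
    have h1 := hT.mono (f k) (fun _ => 0) (hfm k) (hfi k) measurable_const (integrable_const _)
      (h0.mono fun x hx => by simpa using hx.le)
    have h2 := hf k
    rw [h, mul_zero] at h2
    rw [hT.zero] at h1
    linarith
  let c : ℕ → ℝ := fun k => (2 ^ k * ∫ x, f k x ∂μ)⁻¹
  have hc : ∀ k, 0 < c k := fun k => by have := hI k; positivity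
  -- `G` is the sum of multiples of the `f k` with integral `2⁻ᵏ` and risk at least `2ᵏ`.
  let G : E → ℝ≥0∞ := fun x => ∑' k, ENNReal.ofReal (c k * f k x)
  have hGm : Measurable G :=
    Measurable.tsum fun k => ((hfm k).const_mul (c k)).ennreal_ofReal
  have hGint : ∫⁻ x, G x ∂μ ≠ ∞ := by
    have h1 : ∀ k, ∫⁻ x, ENNReal.ofReal (c k * f k x) ∂μ = 2⁻¹ ^ k := by
      intro k
      rw [← ofReal_integral_eq_lintegral_ofReal ((hfi k).const_mul _)
        (ae_of_all _ fun x => mul_nonneg (hc k).le (hf0 k x)), integral_const_mul]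
      have : c k * ∫ x, f k x ∂μ = (2⁻¹ : ℝ) ^ k := by
        have := (hI k).ne'
        simp only [c]
        field_simp
        rw [← mul_pow]; norm_num
      rw [this, ENNReal.ofReal_pow (by norm_num), ENNReal.ofReal_inv_of_pos (by norm_num)]
      simp
    rw [lintegral_tsum fun k => ((hfm k).const_mul (c k)).ennreal_ofReal.aemeasurable]
    simp_rw [h1]
    rw [ENNReal.tsum_geometric]
    simp
  have hGi : Integrable (fun x => (G x).toReal) μ :=
    integrable_toReal_of_lintegral_ne_top hGm.aemeasurable hGint
  have hlow : ∀ k : ℕ, (2 : ℝ) ^ k ≤ T (fun x => (G x).toReal) := by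
    intro k
    have h1 : T (fun x => c k * f k x) ≤ T (fun x => (G x).toReal) := by
      refine hT.mono _ _ ((hfm k).const_mul _) ((hfi k).const_mul _) hGm.ennreal_toReal hGi ?_
      filter_upwards [ae_lt_top hGm hGint] with x hx
      rw [← ENNReal.ofReal_le_iff_le_toReal hx.ne]
      exact ENNReal.le_tsum k
    refine le_trans ?_ h1
    rw [hT.const_mul _ (hfm k) (hfi k) _ (hc k).le]
    have h2 := mul_le_mul_of_nonneg_left (hf k).le (hc k).le
    refine le_trans (le_of_eq ?_) h2
    have := (hI k).ne'
    simp only [c]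
    field_simp
    rw [← pow_mul, mul_comm k 2, pow_mul]; norm_num
  obtain ⟨k, hk⟩ := pow_unbounded_of_one_lt (T fun x => (G x).toReal) (one_lt_two (α := ℝ))
  exact absurd (hlow k) (not_le.2 hk)

/-- A coherent risk functional is Lipschitz continuous with respect to the `L¹` distance. -/
theorem exists_lipschitz (hT : IsCoherentRisk μ T) :
    ∃ C : ℝ, 0 ≤ C ∧ ∀ f g, Measurable f → Integrable f μ → Measurable g → Integrable g μ →
      T f ≤ T g + C * ∫ x, |f x - g x| ∂μ := by
  obtain ⟨C, hC0, hC⟩ := hT.exists_bound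
  refine ⟨C, hC0, fun f g hf hfi hg hgi => ?_⟩
  have hdm : Measurable fun x => |f x - g x| := (hf.sub hg).abs
  have hdi : Integrable (fun x => |f x - g x|) μ := (hfi.sub hgi).abs
  calc T f ≤ T (fun x => g x + |f x - g x|) :=
        hT.mono _ _ hf hfi (hg.add hdm) (hgi.add hdi)
          (ae_of_all _ fun x => by linarith [le_abs_self (f x - g x)])
    _ ≤ T g + T (fun x => |f x - g x|) := hT.add_le _ _ hg hgi hdm hdi
    _ ≤ T g + C * ∫ x, |f x - g x| ∂μ := by
        gcongr
        exact hC _ hdm hdi fun x => abs_nonneg _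

/-- Dominated convergence for coherent risk functionals. -/
theorem tendsto_of_dominated (hT : IsCoherentRisk μ T) {f : ℕ → E → ℝ} {g : E → ℝ} {K : ℝ}
    (hf : ∀ i, Measurable (f i)) (hg : Measurable g) (hfK : ∀ i x, |f i x| ≤ K)
    (hgK : ∀ x, |g x| ≤ K) (hlim : ∀ x, Tendsto (fun i => f i x) atTop (𝓝 (g x))) :
    Tendsto (fun i => T (f i)) atTop (𝓝 (T g)) := by
  obtain ⟨C, hC0, hC⟩ := hT.exists_lipschitz
  have hfi : ∀ i, Integrable (f i) μ := fun i =>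
    Integrable.of_bound (hf i).aestronglyMeasurable K (ae_of_all _ fun x => hfK i x)
  have hgi : Integrable g μ :=
    Integrable.of_bound hg.aestronglyMeasurable K (ae_of_all _ fun x => hgK x)
  have hint : Tendsto (fun i => ∫ x, |f i x - g x| ∂μ) atTop (𝓝 0) := by
    have := tendsto_integral_of_dominated_convergence (μ := μ) (F := fun i x => |f i x - g x|)
      (f := fun _ => 0) (fun _ => K + K)
      (fun i => ((hf i).sub hg).abs.aestronglyMeasurable) (integrable_const _)
      (fun i => ae_of_all _ fun x => by
        rw [Real.norm_eq_abs, abs_abs]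
        exact (abs_sub _ _).trans (add_le_add (hfK i x) (hgK x)))
      (ae_of_all _ fun x => by
        have := ((hlim x).sub_const (g x)).abs
        simpa using this)
    simpa using this
  rw [tendsto_iff_dist_tendsto_zero]
  refine squeeze_zero (fun _ => dist_nonneg) (fun i => ?_) (by simpa using hint.const_mul C)
  rw [Real.dist_eq, abs_le]
  have h1 := hC _ _ (hf i) (hfi i) hg hgi
  have h2 := hC _ _ hg hgi (hf i) (hfi i)
  simp_rw [abs_sub_comm (g _) (f i _)] at h2
  constructor <;> linarith

/-- On an atomless space, a law invariant coherent risk functional is strictly positive on events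
of positive probability: if the event has probability at least `1 / m`, then the space splits
into `m` events of probability `1 / m`, which all have the same risk. -/
theorem indicator_pos (hT : IsCoherentRisk μ T) (hμ : IsAtomless μ) {B : Set E}
    (hB : MeasurableSet B) (hpos : 0 < μ B) : 0 < T (B.indicator fun _ => 1) := by
  obtain ⟨m, hm⟩ := ENNReal.exists_inv_nat_lt hpos.ne'
  have hm0 : m ≠ 0 := by
    rintro rfl
    simp at hm
  have hcm : Measurable fun _ : E => (1 : ℝ) := measurable_const
  have hci : Integrable (fun _ : E => (1 : ℝ)) μ := integrable_const _
  obtain ⟨B', hB'B, hB'm, hB'⟩ := hμ.exists_measure_eq hB hm.le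
  -- Indicators of events with the same probability have the same law.
  have hsame : ∀ s, MeasurableSet s → μ s = (m : ℝ≥0∞)⁻¹ →
      T (s.indicator fun _ => 1) = T (B'.indicator fun _ => 1) := by
    intro s hs hsm
    refine hT.law _ _ (hcm.indicator hs) (hci.indicator hs) (hcm.indicator hB'm)
      (hci.indicator hB'm) ?_
    have hcompl : μ sᶜ = μ B'ᶜ := by
      rw [measure_compl hs (measure_ne_top _ _), measure_compl hB'm (measure_ne_top _ _), hsm, hB']
    ext u hu
    rw [Measure.map_apply (hcm.indicator hs) hu, Measure.map_apply (hcm.indicator hB'm) hu]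
    classical
    rw [Set.indicator_const_preimage_eq_union, Set.indicator_const_preimage_eq_union]
    by_cases h1 : (1 : ℝ) ∈ u <;> by_cases h0 : (0 : ℝ) ∈ u <;>
      simp [h1, h0, hsm, hB', hcompl, Set.union_compl_self]
  have hbound : ∀ k : ℕ, k ≤ m → ∀ s, MeasurableSet s → μ s = k * (m : ℝ≥0∞)⁻¹ →
      T (s.indicator fun _ => 1) ≤ k * T (B'.indicator fun _ => 1) := by
    intro k
    induction k with
    | zero =>
      intro _ s hs hs0
      have h0 : s.indicator (fun _ => (1 : ℝ)) =ᵐ[μ] 0 :=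
        indicator_meas_zero (by simpa using hs0)
      have := hT.mono _ (fun _ => 0) (hcm.indicator hs) (hci.indicator hs) measurable_const
        (integrable_const _) (h0.mono fun x hx => hx.le)
      simpa [hT.zero] using this
    | succ k ih =>
      intro hk s hs hsk
      have hle : (m : ℝ≥0∞)⁻¹ ≤ μ s := by
        rw [hsk]; push_cast; rw [add_mul, one_mul]; exact le_add_self
      obtain ⟨t, hts, htm, ht⟩ := hμ.exists_measure_eq hs hle
      have hd : μ (s \ t) = k * (m : ℝ≥0∞)⁻¹ := by
        rw [measure_sdiff hts htm.nullMeasurableSet (measure_ne_top _ _), hsk, ht]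
        push_cast
        rw [add_mul, one_mul]
        exact ENNReal.add_sub_cancel_right (by simpa using hm0)
      have hsum : s.indicator (fun _ => (1 : ℝ)) =
          fun x => (s \ t).indicator (fun _ => (1 : ℝ)) x + t.indicator (fun _ => (1 : ℝ)) x := by
        rw [← Set.indicator_union_of_disjoint Set.disjoint_sdiff_left,
          Set.sdiff_union_of_subset hts]
      rw [hsum]
      refine (hT.add_le _ _ (hcm.indicator (hs.diff htm)) (hci.indicator (hs.diff htm))
        (hcm.indicator htm) (hci.indicator htm)).trans ?_
      push_cast
      rw [add_mul, one_mul, hsame t htm ht]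
      gcongr
      exact ih (by omega) _ (hs.diff htm) hd
  have h1 := hbound m le_rfl Set.univ MeasurableSet.univ (by
    rw [measure_univ, ENNReal.mul_inv_cancel (by simpa using hm0) (by simp)])
  rw [Set.indicator_univ, hT.one] at h1
  have hB'pos : 0 < T (B'.indicator fun _ => 1) := by
    by_contra! h
    have : (m : ℝ) * T (B'.indicator fun _ => 1) ≤ 0 :=
      mul_nonpos_of_nonneg_of_nonpos (by positivity) h
    linarith
  refine hB'pos.trans_le (hT.mono _ _ (hcm.indicator hB'm) (hci.indicator hB'm) (hcm.indicator hB)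
    (hci.indicator hB) (ae_of_all _ fun x => ?_))
  exact Set.indicator_le_indicator_of_subset hB'B (fun _ => zero_le_one) x

end IsCoherentRisk

/-- The truncation `g ∧ k` of an extended nonnegative function, as a real function. -/
noncomputable def trunc {E : Type*} (g : E → ℝ≥0∞) (k : ℕ) (x : E) : ℝ :=
  (min (g x) (k : ℝ≥0∞)).toReal

section Trunc

variable {E : Type*}

theorem trunc_nonneg (g : E → ℝ≥0∞) (k : ℕ) (x : E) : 0 ≤ trunc g k x := ENNReal.toReal_nonneg

theorem trunc_le (g : E → ℝ≥0∞) (k : ℕ) (x : E) : trunc g k x ≤ k := by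
  have := ENNReal.toReal_mono (ENNReal.natCast_ne_top k) (min_le_right (g x) (k : ℝ≥0∞))
  simpa [trunc] using this

theorem abs_trunc_le (g : E → ℝ≥0∞) (k : ℕ) (x : E) : |trunc g k x| ≤ k := by
  rw [abs_of_nonneg (trunc_nonneg g k x)]
  exact trunc_le g k x

theorem trunc_mono {g g' : E → ℝ≥0∞} {x : E} (h : g x ≤ g' x) (k : ℕ) :
    trunc g k x ≤ trunc g' k x :=
  ENNReal.toReal_mono (ne_top_of_le_ne_top (ENNReal.natCast_ne_top k) (min_le_right _ _))
    (min_le_min_right _ h)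

theorem tendsto_trunc {ι : Type*} {l : Filter ι} {g : ι → E → ℝ≥0∞} {g' : E → ℝ≥0∞} {x : E}
    (h : Tendsto (fun i => g i x) l (𝓝 (g' x))) (k : ℕ) :
    Tendsto (fun i => trunc (g i) k x) l (𝓝 (trunc g' k x)) :=
  (ENNReal.tendsto_toReal
    (ne_top_of_le_ne_top (ENNReal.natCast_ne_top k) (min_le_right _ _))).comp
    (h.min tendsto_const_nhds)

variable [MeasurableSpace E]

theorem measurable_trunc {g : E → ℝ≥0∞} (hg : Measurable g) (k : ℕ) : Measurable (trunc g k) :=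
  (hg.min measurable_const).ennreal_toReal

theorem integrable_trunc {μ : Measure E} [IsFiniteMeasure μ] {g : E → ℝ≥0∞} (hg : Measurable g)
    (k : ℕ) : Integrable (trunc g k) μ :=
  Integrable.of_bound (measurable_trunc hg k).aestronglyMeasurable k
    (ae_of_all _ fun x => by simpa using abs_trunc_le g k x)

end Trunc

/-- The monotone extension of a static risk functional to functions with values in `[0, ∞]`, the
static counterpart of `extend`. -/
noncomputable def extendRisk {E : Type*} (T : (E → ℝ) → ℝ) (g : E → ℝ≥0∞) : ℝ≥0∞ :=
  ⨆ k : ℕ, ENNReal.ofReal (T (trunc g k))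

namespace IsCoherentRisk

variable {E : Type*} [MeasurableSpace E] {μ : Measure E} [IsProbabilityMeasure μ]
  {T : (E → ℝ) → ℝ}

theorem extendRisk_mono (hT : IsCoherentRisk μ T) {g g' : E → ℝ≥0∞} (hg : Measurable g)
    (hg' : Measurable g') (h : ∀ᵐ x ∂μ, g x ≤ g' x) : extendRisk T g ≤ extendRisk T g' :=
  iSup_mono fun k => ENNReal.ofReal_le_ofReal <|
    hT.mono _ _ (measurable_trunc hg k) (integrable_trunc hg k) (measurable_trunc hg' k)
      (integrable_trunc hg' k) (h.mono fun _ hx => trunc_mono hx k)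

/-- The extended risk functional is continuous from below. -/
theorem extendRisk_iSup (hT : IsCoherentRisk μ T) {g : ℕ → E → ℝ≥0∞}
    (hg : ∀ i, Measurable (g i)) (hmono : Monotone g) :
    extendRisk T (fun x => ⨆ i, g i x) = ⨆ i, extendRisk T (g i) := by
  have hsup : Measurable fun x => ⨆ i, g i x := Measurable.iSup hg
  refine le_antisymm (iSup_le fun k => ?_) (iSup_le fun i =>
    hT.extendRisk_mono (hg i) hsup (ae_of_all _ fun x => le_iSup (fun i => g i x) i))
  have hlim : Tendsto (fun i => T (trunc (g i) k)) atTop (𝓝 (T (trunc (fun x => ⨆ i, g i x) k))) :=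
    hT.tendsto_of_dominated (fun i => measurable_trunc (hg i) k) (measurable_trunc hsup k)
      (fun i x => abs_trunc_le _ k x) (fun x => abs_trunc_le _ k x)
      fun x => tendsto_trunc (tendsto_atTop_iSup fun i j hij => hmono hij x) k
  exact le_of_tendsto' (ENNReal.tendsto_ofReal hlim) fun i =>
    (le_iSup (fun k => ENNReal.ofReal (T (trunc (g i) k))) k).trans
      (le_iSup (fun i => extendRisk T (g i)) i)

/-- Fatou's lemma for the extended risk functional. -/
theorem extendRisk_le_liminf (hT : IsCoherentRisk μ T) {g : ℕ → E → ℝ≥0∞} {g' : E → ℝ≥0∞}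
    (hg : ∀ i, Measurable (g i)) (hg' : Measurable g')
    (h : ∀ x, g' x ≤ liminf (fun i => g i x) atTop) :
    extendRisk T g' ≤ liminf (fun i => extendRisk T (g i)) atTop := by
  have hinf : ∀ m, Measurable fun x => ⨅ i, g (i + m) x := fun m =>
    Measurable.iInf fun i => hg (i + m)
  have heq : ∀ x, liminf (fun i => g i x) atTop = ⨆ m, ⨅ i, g (i + m) x := fun x =>
    liminf_eq_iSup_iInf_of_nat'
  have hmono : Monotone fun (m : ℕ) x => ⨅ i, g (i + m) x := by
    intro m m' hm x
    refine le_iInf fun i => ?_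
    have h1 := iInf_le (fun i => g (i + m) x) (i + (m' - m))
    rwa [show i + (m' - m) + m = i + m' by have : m ≤ m' := hm; omega] at h1
  calc extendRisk T g' ≤ extendRisk T (fun x => ⨆ m, ⨅ i, g (i + m) x) :=
        hT.extendRisk_mono hg' (Measurable.iSup hinf) (ae_of_all _ fun x => (heq x) ▸ h x)
    _ = ⨆ m, extendRisk T (fun x => ⨅ i, g (i + m) x) := hT.extendRisk_iSup hinf hmono
    _ ≤ ⨆ m, ⨅ i, extendRisk T (g (i + m)) := iSup_mono fun m => le_iInf fun i =>
        hT.extendRisk_mono (hinf m) (hg _) (ae_of_all _ fun x => iInf_le _ i)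
    _ = liminf (fun i => extendRisk T (g i)) atTop :=
        (liminf_eq_iSup_iInf_of_nat' (u := fun i => extendRisk T (g i))).symm

/-- On an atomless space, only almost surely finite random variables have finite risk. -/
theorem ae_lt_top_of_extendRisk (hT : IsCoherentRisk μ T) (hμ : IsAtomless μ) {g : E → ℝ≥0∞}
    (hg : Measurable g) (hfin : extendRisk T g < ∞) : ∀ᵐ x ∂μ, g x < ∞ := by
  by_contra hcon
  have hBm : MeasurableSet {x | g x = ∞} := hg (measurableSet_singleton ∞)
  have hpos : 0 < μ {x | g x = ∞} := by
    refine pos_iff_ne_zero.2 fun h => hcon ?_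
    rw [ae_iff]
    simpa using h
  have hB := hT.indicator_pos hμ hBm hpos
  set b := T ({x | g x = ∞}.indicator fun _ => 1)
  have hk : ∀ k : ℕ, ENNReal.ofReal (k * b) ≤ extendRisk T g := by
    intro k
    refine le_trans (ENNReal.ofReal_le_ofReal ?_)
      (le_iSup (fun k => ENNReal.ofReal (T (trunc g k))) k)
    have h1 : Measurable ({x | g x = ∞}.indicator fun _ => (1 : ℝ)) :=
      measurable_const.indicator hBm
    have h2 : Integrable ({x | g x = ∞}.indicator fun _ => (1 : ℝ)) μ :=
      (integrable_const _).indicator hBm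
    rw [← hT.const_mul _ h1 h2 k (by positivity)]
    refine hT.mono _ _ (h1.const_mul _) (h2.const_mul _) (measurable_trunc hg k)
      (integrable_trunc hg k) (ae_of_all _ fun x => ?_)
    by_cases hx : g x = ∞
    · simp [trunc, hx]
    · simpa [hx] using trunc_nonneg g k x
  obtain ⟨k, hk'⟩ := exists_nat_gt ((extendRisk T g).toReal / b)
  rw [div_lt_iff₀ hB, ← ENNReal.lt_ofReal_iff_toReal_lt hfin.ne] at hk'
  exact absurd hk' (not_lt.2 (hk k))

/-- The risk of a jointly measurable bounded function depends measurably on the parameter. Indeed,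
by Lipschitz continuity `T f` is the infimum of `T h + C ‖f - h‖₁` over a countable set of `h` that
is dense in `L¹`. -/
theorem measurable_parameter (hT : IsCoherentRisk μ T) {S Y : Type*} [MeasurableSpace S]
    [MeasurableSpace.CountablyGenerated S] [MeasurableSpace Y] {ξ : E → S} (hξ : Measurable ξ)
    {φ : Y × S → ℝ} (hφ : Measurable φ) {K : ℝ} (hK : ∀ p, |φ p| ≤ K) :
    Measurable fun y => T fun x => φ (y, ξ x) := by
  obtain ⟨C, hC0, hC⟩ := hT.exists_lipschitz
  let ν : Measure S := μ.map ξ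
  have : Fact ((1 : ℝ≥0∞) ≠ ∞) := ⟨ENNReal.one_ne_top⟩
  have : IsProbabilityMeasure ν := Measure.isProbabilityMeasure_map hξ.aemeasurable
  let D : ℕ → Lp ℝ 1 ν := TopologicalSpace.denseSeq _
  have hmeas : ∀ i, ∃ h : S → ℝ, Measurable h ∧ Integrable h ν ∧ D i =ᵐ[ν] h := by
    intro i
    have h1 := Lp.aestronglyMeasurable (D i)
    exact ⟨h1.mk _, h1.stronglyMeasurable_mk.measurable,
      ((L1.integrable_coeFn (D i)).congr h1.ae_eq_mk), h1.ae_eq_mk⟩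
  choose h hhm hhi hhD using hmeas
  have hφy : ∀ y, Measurable fun s => φ (y, s) := fun y => hφ.comp measurable_prodMk_left
  have hφi : ∀ y, Integrable (fun s => φ (y, s)) ν := fun y =>
    Integrable.of_bound (hφy y).aestronglyMeasurable K (ae_of_all _ fun s => hK _)
  have hpull : ∀ f : S → ℝ, Measurable f → ∫ x, f (ξ x) ∂μ = ∫ s, f s ∂ν := fun f hf =>
    (integral_map hξ.aemeasurable hf.aestronglyMeasurable).symm
  have hpulli : ∀ f : S → ℝ, Measurable f → Integrable f ν → Integrable (fun x => f (ξ x)) μ :=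
    fun f hf hfi => hfi.comp_measurable hξ
  have hφx : ∀ y, Measurable fun x => φ (y, ξ x) := fun y => (hφy y).comp hξ
  have hle : ∀ y i, T (fun x => φ (y, ξ x)) ≤
      T (fun x => h i (ξ x)) + C * ∫ s, |φ (y, s) - h i s| ∂ν := by
    intro y i
    rw [← hpull (fun s => |φ (y, s) - h i s|) ((hφy y).sub (hhm i)).abs]
    exact hC _ _ (hφx y) (hpulli _ (hφy y) (hφi y)) ((hhm i).comp hξ) (hpulli _ (hhm i) (hhi i))
  have hge : ∀ y i, T (fun x => h i (ξ x)) ≤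
      T (fun x => φ (y, ξ x)) + C * ∫ s, |φ (y, s) - h i s| ∂ν := by
    intro y i
    simp_rw [abs_sub_comm (φ _) (h i _)]
    rw [← hpull (fun s => |h i s - φ (y, s)|) ((hhm i).sub (hφy y)).abs]
    exact hC _ _ ((hhm i).comp hξ) (hpulli _ (hhm i) (hhi i)) (hφx y) (hpulli _ (hφy y) (hφi y))
  have hdense : ∀ y, ∀ ε > 0, ∃ i, ∫ s, |φ (y, s) - h i s| ∂ν < ε := by
    intro y ε hε
    obtain ⟨i, hi⟩ := (TopologicalSpace.denseRange_denseSeq (Lp ℝ 1 ν)).exists_dist_lt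
      ((hφi y).toL1 _) hε
    refine ⟨i, lt_of_eq_of_lt ?_ hi⟩
    rw [L1.dist_eq_integral_dist]
    refine integral_congr_ae ?_
    filter_upwards [hhD i, (hφi y).coeFn_toL1] with s h1 h2
    rw [h2, Real.dist_eq, ← h1]
  have hformula : (fun y => T fun x => φ (y, ξ x)) =
      fun y => ⨅ i, (T (fun x => h i (ξ x)) + C * ∫ s, |φ (y, s) - h i s| ∂ν) := by
    funext y
    refine le_antisymm (le_ciInf (hle y)) (le_of_forall_pos_le_add fun ε hε => ?_)
    obtain ⟨i, hi⟩ := hdense y (ε / (2 * (C + 1))) (by positivity)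
    refine (ciInf_le ⟨_, Set.forall_mem_range.2 (hle y)⟩ i).trans ?_
    have h1 := hge y i
    have h2 : C * ∫ s, |φ (y, s) - h i s| ∂ν ≤ ε / 2 := by
      calc C * ∫ s, |φ (y, s) - h i s| ∂ν ≤ (C + 1) * (ε / (2 * (C + 1))) := by
            gcongr
            linarith
        _ = ε / 2 := by field_simp
    linarith
  rw [hformula]
  refine Measurable.iInf fun i => measurable_const.add (Measurable.const_mul ?_ C)
  have hjoint : StronglyMeasurable fun p : Y × S => |φ p - h i p.2| :=
    (hφ.sub ((hhm i).comp measurable_snd)).abs.stronglyMeasurable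
  exact hjoint.integral_prod_right.measurable

theorem measurable_extendRisk (hT : IsCoherentRisk μ T) {S Y : Type*} [MeasurableSpace S]
    [MeasurableSpace.CountablyGenerated S] [MeasurableSpace Y] {ξ : E → S} (hξ : Measurable ξ)
    {φ : Y × S → ℝ≥0∞} (hφ : Measurable φ) :
    Measurable fun y => extendRisk T fun x => φ (y, ξ x) :=
  Measurable.iSup fun k => (hT.measurable_parameter hξ (measurable_trunc hφ k)
    (fun p => abs_trunc_le φ k p)).ennreal_ofReal

end IsCoherentRisk

/-! ### Measurable selection -/

/-- A measurable selection theorem of Kuratowski and Ryll-Nardzewski, for compact values: the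
selector is the point that is left when the values are cut down successively by balls of radius
`1 / (k + 1)` with centers in a dense sequence, always taking the first ball that meets what is
left. -/
theorem exists_measurable_selector {X A : Type*} [MeasurableSpace X] [TopologicalSpace A]
    [PolishSpace A] [MeasurableSpace A] [BorelSpace A] (Ψ : X → Set A)
    (hne : ∀ x, (Ψ x).Nonempty) (hcomp : ∀ x, IsCompact (Ψ x))
    (hmeas : ∀ C, IsClosed C → MeasurableSet {x | (Ψ x ∩ C).Nonempty}) :
    ∃ σ : X → A, Measurable σ ∧ ∀ x, σ x ∈ Ψ x := by
  classical
  rcases isEmpty_or_nonempty X with hX | ⟨⟨x₀⟩⟩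
  · exact ⟨fun x => isEmptyElim x, measurable_of_empty _, fun x => isEmptyElim x⟩
  have hA : Nonempty A := ⟨(hne x₀).some⟩
  let := TopologicalSpace.upgradeIsCompletelyMetrizable A
  let d : ℕ → A := TopologicalSpace.denseSeq A
  let B : ℕ → ℕ → Set A := fun k i => Metric.closedBall (d i) (1 / ((k : ℝ) + 1))
  let P : (X → Set A) → Prop := fun Θ =>
    (∀ x, (Θ x).Nonempty) ∧ (∀ x, IsCompact (Θ x)) ∧
      ∀ C, IsClosed C → MeasurableSet {x | (Θ x ∩ C).Nonempty}
  have step : ∀ (k : ℕ) (Θ : X → Set A), P Θ →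
      ∃ i : X → ℕ, Measurable i ∧ P fun x => Θ x ∩ B k (i x) := by
    rintro k Θ ⟨h1, h2, h3⟩
    have hex : ∀ x, ∃ i, (Θ x ∩ B k i).Nonempty := by
      intro x
      obtain ⟨a, ha⟩ := h1 x
      obtain ⟨i, hi⟩ := (TopologicalSpace.denseRange_denseSeq A).exists_dist_lt a
        (show (0 : ℝ) < 1 / ((k : ℝ) + 1) by positivity)
      exact ⟨i, a, ha, hi.le⟩
    have him : Measurable fun x => Nat.find (hex x) :=
      measurable_find hex fun i => h3 _ Metric.isClosed_closedBall
    refine ⟨fun x => Nat.find (hex x), him, fun x => Nat.find_spec (hex x),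
      fun x => (h2 x).inter_right Metric.isClosed_closedBall, fun C hC => ?_⟩
    have : {x | ((Θ x ∩ B k (Nat.find (hex x))) ∩ C).Nonempty} =
        ⋃ i, {x | Nat.find (hex x) = i} ∩ {x | (Θ x ∩ (B k i ∩ C)).Nonempty} := by
      ext x
      simp [Set.inter_assoc]
    rw [this]
    exact MeasurableSet.iUnion fun i => (him (measurableSet_singleton i)).inter
      (h3 _ (Metric.isClosed_closedBall.inter hC))
  choose! g hg1 hg2 using step
  let Θ : ℕ → X → Set A := fun k => Nat.rec Ψ (fun k Θ x => Θ x ∩ B k (g k Θ x)) k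
  have hΘ : ∀ k, P (Θ k) := by
    intro k
    induction k with
    | zero => exact ⟨hne, hcomp, hmeas⟩
    | succ k ih => exact hg2 k (Θ k) ih
  have hsel : ∀ x, (⋂ k, Θ k x).Nonempty := fun x =>
    IsCompact.nonempty_iInter_of_sequence_nonempty_isCompact_isClosed _
      (fun k => Set.inter_subset_left) (fun k => (hΘ k).1 x) ((hΘ 0).2.1 x)
      fun k => ((hΘ k).2.1 x).isClosed
  choose σ hσ using hsel
  have hσ' : ∀ x k, σ x ∈ Θ k x := fun x k => Set.mem_iInter.1 (hσ x) k
  refine ⟨σ, ?_, fun x => hσ' x 0⟩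
  refine measurable_of_tendsto_metrizable (f := fun k x => d (g k (Θ k) x))
    (fun k => (measurable_of_countable d).comp (hg1 k _ (hΘ k))) ?_
  rw [tendsto_pi_nhds]
  intro x
  rw [tendsto_iff_dist_tendsto_zero]
  refine squeeze_zero (fun _ => dist_nonneg) (fun k => ?_) tendsto_one_div_add_atTop_nhds_zero_nat
  have : σ x ∈ B k (g k (Θ k) x) := (hσ' x (k + 1)).2
  rw [dist_comm]
  exact this

/-! ### Minimization over semicontinuous multifunctions -/

section Minimization

variable {X A : Type*} [TopologicalSpace X] [TopologicalSpace A] {Φ : X → Set A}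

/-- Berge's theorem: infima of a lower semicontinuous function over an upper semicontinuous
compact-valued multifunction, restricted to a closed set, are lower semicontinuous. -/
theorem lowerSemicontinuous_iInf_inter (hΦ : UpperHemicontinuous Φ) (hc : ∀ x, IsCompact (Φ x))
    {h : Graph Φ → ℝ≥0∞} (hh : LowerSemicontinuous h) {C : Set A} (hC : IsClosed C) :
    LowerSemicontinuous fun x => ⨅ (a : Φ x) (_ : (a : A) ∈ C), h ⟨(x, a), a.2⟩ := by
  intro x t ht
  obtain ⟨t', htt', ht'⟩ := exists_between ht
  obtain ⟨O, hO, hOeq⟩ := isOpen_induced_iff.1 (hh.isOpen_preimage t')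
  have hmemO : ∀ p : Graph Φ, (p : X × A) ∈ O ↔ t' < h p := fun p => by
    rw [← Set.mem_preimage, hOeq]; rfl
  have hsub : {x} ×ˢ (Φ x ∩ C) ⊆ O := by
    rintro ⟨x', a⟩ ⟨rfl, ha, haC⟩
    exact (hmemO ⟨(x', a), ha⟩).2 (ht'.trans_le (iInf₂_le (⟨a, ha⟩ : Φ x') haC))
  obtain ⟨U, V, hU, hV, hxU, hxV, hUV⟩ :=
    generalized_tube_lemma isCompact_singleton ((hc x).inter_right hC) hO hsub
  have hVC : V ∪ Cᶜ ∈ 𝓝ˢ (Φ x) := by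
    refine (hV.union hC.isOpen_compl).mem_nhdsSet.2 fun a ha => ?_
    by_cases haC : a ∈ C
    · exact Or.inl (hxV ⟨ha, haC⟩)
    · exact Or.inr haC
  filter_upwards [hU.mem_nhds (hxU rfl), hΦ x _ hVC] with x' hx'U hx'V
  refine htt'.trans_le (le_iInf₂ fun a haC => ?_)
  have haV : (a : A) ∈ V := (subset_of_mem_nhdsSet hx'V a.2).resolve_right fun h => h haC
  exact ((hmemO ⟨(x', a), a.2⟩).1 (hUV ⟨hx'U, haV⟩)).le

theorem isClosed_setOf_inter_nonempty (hΦ : UpperHemicontinuous Φ) {C : Set A}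
    (hC : IsClosed C) :
    IsClosed {x | (Φ x ∩ C).Nonempty} := by
  rw [← isOpen_compl_iff, isOpen_iff_mem_nhds]
  intro x hx
  have hxC : ∀ x, x ∈ {x | (Φ x ∩ C).Nonempty}ᶜ ↔ Φ x ⊆ Cᶜ := fun x => by
    rw [Set.mem_compl_iff, Set.mem_ofPred_eq, Set.not_nonempty_iff_eq_empty,
      Set.subset_compl_iff_disjoint_right, Set.disjoint_iff_inter_eq_empty]
  filter_upwards [hΦ x _ (hC.isOpen_compl.mem_nhdsSet.2 ((hxC x).1 hx))] with x' hx'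
  exact (hxC x').2 (subset_of_mem_nhdsSet hx')

theorem lowerSemicontinuous_section {h : Graph Φ → ℝ≥0∞} (hh : LowerSemicontinuous h) (x : X) :
    LowerSemicontinuous fun a : Φ x => h ⟨(x, a), a.2⟩ :=
  fun a t ht =>
    (show Continuous fun a : Φ x => (⟨(x, a), a.2⟩ : Graph Φ) by fun_prop).continuousAt.eventually
      (hh ⟨(x, a), a.2⟩ t ht)

theorem exists_isMin_inter (hc : ∀ x, IsCompact (Φ x)) {h : Graph Φ → ℝ≥0∞}
    (hh : LowerSemicontinuous h) {C : Set A} (hC : IsClosed C) {x : X}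
    (hne : (Φ x ∩ C).Nonempty) :
    ∃ a : Φ x, (a : A) ∈ C ∧
      h ⟨(x, a), a.2⟩ = ⨅ (a : Φ x) (_ : (a : A) ∈ C), h ⟨(x, a), a.2⟩ := by
  have : CompactSpace (Φ x) := isCompact_iff_compactSpace.1 (hc x)
  obtain ⟨b, hb, hbC⟩ := hne
  obtain ⟨a, haC, ha⟩ := LowerSemicontinuousOn.exists_isMinOn
    (s := (fun a : Φ x => (a : A)) ⁻¹' C) ⟨⟨b, hb⟩, hbC⟩
    (hC.preimage continuous_subtype_val).isCompact
    ((lowerSemicontinuous_section hh x).lowerSemicontinuousOn _)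
  exact ⟨a, haC, le_antisymm (le_iInf₂ fun a' ha' => ha ha') (iInf₂_le a haC)⟩

/-- A measurable selection of points at which a lower semicontinuous function on the graph is at
most a given measurable function of the base point. -/
theorem exists_measurable_selector_le [MeasurableSpace X] [BorelSpace X] [PolishSpace A]
    [MeasurableSpace A] [BorelSpace A] (hΦ : UpperHemicontinuous Φ) (hc : ∀ x, IsCompact (Φ x))
    {h : Graph Φ → ℝ≥0∞} (hh : LowerSemicontinuous h) {v : X → ℝ≥0∞} (hv : Measurable v)
    (hex : ∀ x, ∃ a : Φ x, h ⟨(x, a), a.2⟩ ≤ v x) :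
    ∃ σ : X → A, Measurable σ ∧ ∀ x, ∃ ha : σ x ∈ Φ x, h ⟨(x, σ x), ha⟩ ≤ v x := by
  let Ψ : X → Set A := fun x => {a | ∃ ha : a ∈ Φ x, h ⟨(x, a), ha⟩ ≤ v x}
  refine exists_measurable_selector Ψ (fun x => ?_) (fun x => ?_) (fun C hC => ?_)
  · obtain ⟨a, ha⟩ := hex x
    exact ⟨a, a.2, ha⟩
  · have : CompactSpace (Φ x) := isCompact_iff_compactSpace.1 (hc x)
    have himg : Ψ x = (fun a : Φ x => (a : A)) '' {a | h ⟨(x, a), a.2⟩ ≤ v x} := by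
      ext a
      simp [Ψ]
    rw [himg]
    exact (((lowerSemicontinuous_section hh x).isClosed_preimage (v x)).isCompact).image
      continuous_subtype_val
  -- A minimizer over `Φ x ∩ C` exists unless this set is empty, where the infimum is `∞` and may
  -- still be at most `v x`; hence the first of the two conditions.
  · have heq : {x | (Ψ x ∩ C).Nonempty} = {x | (Φ x ∩ C).Nonempty} ∩
        {x | ⨅ (a : Φ x) (_ : (a : A) ∈ C), h ⟨(x, a), a.2⟩ ≤ v x} := by
      ext x
      constructor
      · rintro ⟨a, ⟨ha, hle⟩, haC⟩
        have hinf : ⨅ (a : Φ x) (_ : (a : A) ∈ C), h ⟨(x, a), a.2⟩ ≤ v x :=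
          iInf₂_le_of_le (⟨a, ha⟩ : Φ x) haC hle
        exact ⟨⟨a, ha, haC⟩, hinf⟩
      · rintro ⟨hne, hle⟩
        obtain ⟨a, haC, ha⟩ := exists_isMin_inter hc hh hC hne
        exact ⟨a, ⟨a.2, ha.le.trans hle⟩, haC⟩
    rw [heq]
    exact (isClosed_setOf_inter_nonempty hΦ hC).measurableSet.inter
      (measurableSet_le (lowerSemicontinuous_iInf_inter hΦ hc hh hC).measurable hv)

/-- On a compact set, minimization commutes with increasing limits of lower semicontinuous
functions. -/
theorem exists_forall_le_iSup_iInf {K : Type*} [TopologicalSpace K] [CompactSpace K] [Nonempty K]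
    {h : ℕ → K → ℝ≥0∞} (hh : ∀ k, LowerSemicontinuous (h k)) (hmono : Monotone h) :
    ∃ a, ∀ k, h k a ≤ ⨆ k, ⨅ a, h k a := by
  have hcl : ∀ k, IsClosed {a | h k a ≤ ⨆ k, ⨅ a, h k a} := fun k =>
    (hh k).isClosed_preimage _
  have hne : ∀ k, {a | h k a ≤ ⨆ k, ⨅ a, h k a}.Nonempty := fun k => by
    obtain ⟨a, -, ha⟩ := LowerSemicontinuousOn.exists_isMinOn (s := Set.univ) Set.univ_nonempty
      isCompact_univ ((hh k).lowerSemicontinuousOn _)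
    exact ⟨a, (le_iInf fun b => ha (Set.mem_univ b)).trans
      (le_iSup (fun k => ⨅ a, h k a) k)⟩
  obtain ⟨a, ha⟩ := IsCompact.nonempty_iInter_of_sequence_nonempty_isCompact_isClosed
    (fun k => {a | h k a ≤ ⨆ k, ⨅ a, h k a}) (fun k a ha => (hmono k.le_succ a).trans ha)
    hne (hcl 0).isCompact hcl
  exact ⟨a, fun k => Set.mem_iInter.1 ha k⟩

end Minimization

/-! ### Risk mappings conditioned on the history -/

section Extend

variable {E : Type*} {m m' m₀ : MeasurableSpace E} {P : Measure E} [IsFiniteMeasure P]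
  {ρ : (E → ℝ) → (E → ℝ)}

theorem memZ_trunc (hm' : m' ≤ m₀) {Z : E → ℝ≥0∞} (hZ : Measurable[m'] Z) (k : ℕ) :
    MemZ m' P (trunc Z k) :=
  ⟨@measurable_trunc E m' Z hZ k, integrable_trunc (hZ.mono hm' le_rfl) k⟩

theorem IsCondRiskMapping.measurable_extend (hρ : IsCondRiskMapping m m' P ρ) (hm' : m' ≤ m₀)
    {Z : E → ℝ≥0∞} (hZ : Measurable[m'] Z) : Measurable[m] (extend ρ Z) :=
  Measurable.iSup (mδ := m) fun k =>
    ((hρ.maps_to _ (memZ_trunc hm' hZ k)).1).ennreal_ofReal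

theorem IsCondRiskMapping.extend_congr (hρ : IsCondRiskMapping m m' P ρ) (hm' : m' ≤ m₀)
    {Z Z' : E → ℝ≥0∞} (hZ : Measurable[m'] Z) (hZ' : Measurable[m'] Z') (h : Z =ᵐ[P] Z') :
    extend ρ Z =ᵐ[P] extend ρ Z' := by
  have key : ∀ k : ℕ, ρ (trunc Z k) =ᵐ[P] ρ (trunc Z' k) := fun k => by
    filter_upwards [hρ.mono _ _ (memZ_trunc hm' hZ k) (memZ_trunc hm' hZ' k)
        (h.mono fun _ hx => trunc_mono hx.le k),
      hρ.mono _ _ (memZ_trunc hm' hZ' k) (memZ_trunc hm' hZ k)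
        (h.mono fun _ hx => trunc_mono hx.ge k)] with ω h1 h2
    exact le_antisymm h1 h2
  filter_upwards [ae_all_iff.2 key] with ω hω
  exact iSup_congr fun k => congrArg ENNReal.ofReal (hω k)

end Extend

namespace ControlModel

variable {X A S Ω : ℕ → Type*}
  [∀ n, TopologicalSpace (X n)] [∀ n, TopologicalSpace (A n)]
  [∀ n, TopologicalSpace (S n)] [∀ n, MeasurableSpace (S n)] [∀ n, MeasurableSpace (Ω n)]
  (M : ControlModel X A S Ω)

theorem measurable_hist (n : ℕ) : Measurable (hist Ω n) :=
  measurable_pi_lambda _ fun i => measurable_pi_apply (i : ℕ)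

theorem filt_le (n : ℕ) : filt Ω n ≤ MeasurableSpace.pi := (measurable_hist n).comap_le

theorem measurable_filt_hist (n : ℕ) : Measurable[filt Ω n] (hist Ω n) := comap_measurable _

theorem measurable_filt_eval {n i : ℕ} (hi : i < n) :
    Measurable[filt Ω n] fun ω : ∀ i, Ω i => ω i :=
  (measurable_pi_apply (⟨i, hi⟩ : Set.Iio n)).comp (measurable_filt_hist n)

theorem filt_mono {n n' : ℕ} (h : n ≤ n') : filt Ω n ≤ filt Ω n' := by
  refine Measurable.comap_le ?_
  exact @measurable_pi_lambda _ _ _ (filt Ω n') _ _ fun i =>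
    measurable_filt_eval (lt_of_lt_of_le i.2 h)

/-- The noise at time `n` is independent of the history. -/
theorem map_hist_eval (n : ℕ) :
    M.prob.map (fun ω => (hist Ω n ω, ω n)) =
      (M.prob.map (hist Ω n)).prod (M.noise n : Measure (Ω n)) := by
  have hind : iIndepFun (fun i (ω : ∀ i, Ω i) => ω i) M.prob :=
    iIndepFun_infinitePi (X := fun i (ω : Ω i) => ω) fun i => measurable_id
  have h1 := hind.indepFun_finset (Finset.Iio n) {n} (by simp) fun i => measurable_pi_apply i
  have h2 : IndepFun (hist Ω n) (fun ω : ∀ i, Ω i => ω n) M.prob :=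
    h1.comp (φ := fun (h : ∀ i : Finset.Iio n, Ω i) (i : Set.Iio n) =>
        h ⟨i, Finset.mem_Iio.2 i.2⟩)
      (ψ := fun h : ∀ i : ({n} : Finset ℕ), Ω i => h ⟨n, Finset.mem_singleton_self n⟩)
      (measurable_pi_lambda _ fun i => measurable_pi_apply _) (measurable_pi_apply _)
  rw [(indepFun_iff_map_prod_eq_prod_map_map (measurable_hist n).aemeasurable
    (measurable_pi_apply n).aemeasurable).1 h2]
  congr 1
  exact Measure.infinitePi_map_eval _ n

/-- The regular conditional law of a function of the history and of the present noise, given the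
history. -/
theorem condDistrib_hist (n : ℕ) {φ : (∀ i : Set.Iio n, Ω i) × Ω n → ℝ} (hφ : Measurable φ) :
    ∀ᵐ ω ∂M.prob, condDistrib (fun ω' => φ (hist Ω n ω', ω' n)) (hist Ω n) M.prob (hist Ω n ω) =
      (M.noise n : Measure (Ω n)).map fun w => φ (hist Ω n ω, w) := by
  let κ : Kernel (∀ i : Set.Iio n, Ω i) ℝ :=
    (Kernel.id ×ₖ Kernel.const _ (M.noise n : Measure (Ω n))).map φ
  have hκ : ∀ h, κ h = (M.noise n : Measure (Ω n)).map fun w => φ (h, w) := by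
    intro h
    rw [Kernel.map_apply _ hφ, Kernel.prod_apply, Kernel.id_apply, Kernel.const_apply,
      Measure.dirac_prod, Measure.map_map hφ measurable_prodMk_left]
    rfl
  have hpair : Measurable fun ω : ∀ i, Ω i => (hist Ω n ω, ω n) :=
    (measurable_hist n).prodMk (measurable_pi_apply n)
  have hcomp : M.prob.map (fun ω => (hist Ω n ω, φ (hist Ω n ω, ω n))) =
      M.prob.map (hist Ω n) ⊗ₘ κ := by
    have hψ : Measurable fun p : (∀ i : Set.Iio n, Ω i) × Ω n => (p.1, φ p) :=
      measurable_fst.prodMk hφ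
    have h1 : M.prob.map (fun ω => (hist Ω n ω, φ (hist Ω n ω, ω n))) =
        ((M.prob.map (hist Ω n)).prod (M.noise n : Measure (Ω n))).map fun p => (p.1, φ p) := by
      rw [← M.map_hist_eval, Measure.map_map hψ hpair]
      rfl
    have : IsProbabilityMeasure (M.prob.map (hist Ω n)) :=
      Measure.isProbabilityMeasure_map (measurable_hist n).aemeasurable
    rw [h1]
    ext s hs
    rw [Measure.map_apply hψ hs, Measure.prod_apply (hψ hs), Measure.compProd_apply hs]
    refine lintegral_congr fun h => ?_
    have hφh : Measurable fun w => φ (h, w) := hφ.comp measurable_prodMk_left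
    rw [hκ, Measure.map_apply hφh (measurable_prodMk_left hs)]
    rfl
  have := condDistrib_ae_eq_of_measure_eq_compProd_of_measurable (measurable_hist n)
    (hφ.comp hpair) hcomp
  filter_upwards [ae_of_ae_map (measurable_hist n).aemeasurable this] with ω hω
  rw [← hκ, ← hω]
  rfl

/-- The conditional risk mapping `ρ` at time `n` acts on functions of the history and of the noise
at time `n` through the static risk functional `T` for the noise, with the history frozen. -/
def IsFrozenRisk (n : ℕ) (ρ : ((∀ i, Ω i) → ℝ) → ((∀ i, Ω i) → ℝ)) (T : (Ω n → ℝ) → ℝ) : Prop :=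
  ∀ φ : (∀ i : Set.Iio n, Ω i) × Ω n → ℝ, Measurable φ →
    Integrable (fun ω => φ (hist Ω n ω, ω n)) M.prob →
    ∀ᵐ ω ∂M.prob, ρ (fun ω' => φ (hist Ω n ω', ω' n)) ω = T fun w => φ (hist Ω n ω, w)

variable {M}

theorem integrable_eval {n : ℕ} {f : Ω n → ℝ} (hfi : Integrable f (M.noise n : Measure (Ω n))) :
    Integrable (fun ω : ∀ i, Ω i => f (ω n)) M.prob := by
  have h : MeasurePreserving (fun ω : ∀ i, Ω i => ω n) M.prob (M.noise n : Measure (Ω n)) :=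
    ⟨measurable_pi_apply n, Measure.infinitePi_map_eval _ n⟩
  exact h.integrable_comp_of_integrable hfi

/-- Law invariance turns a conditional risk mapping into a static coherent risk functional for the
noise, with the history frozen. -/
theorem exists_frozenRisk {ρ : ℕ → ((∀ i, Ω i) → ℝ) → ((∀ i, Ω i) → ℝ)}
    (hρ : M.IsRiskSystem ρ) (n : ℕ) :
    ∃ T : (Ω n → ℝ) → ℝ, IsCoherentRisk (M.noise n : Measure (Ω n)) T ∧
      M.IsFrozenRisk n (ρ n) T := by
  obtain ⟨hc, R, hR⟩ := hρ n
  let T : (Ω n → ℝ) → ℝ := fun f => R ((M.noise n : Measure (Ω n)).map f)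
  have hfrozen : M.IsFrozenRisk n (ρ n) T := by
    intro φ hφ hint
    have hmem : MemZ (filt Ω (n + 1)) M.prob fun ω => φ (hist Ω n ω, ω n) :=
      ⟨hφ.comp (((measurable_filt_hist n).mono (filt_mono n.le_succ) le_rfl).prodMk
        (measurable_filt_eval n.lt_succ_self)), hint⟩
    filter_upwards [hR _ hmem, M.condDistrib_hist n hφ] with ω h1 h2
    rw [h1, h2]
  have hmem : ∀ f : Ω n → ℝ, Measurable f → Integrable f (M.noise n : Measure (Ω n)) →
      MemZ (filt Ω (n + 1)) M.prob fun ω => f (ω n) := fun f hf hfi =>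
    ⟨hf.comp (measurable_filt_eval n.lt_succ_self), integrable_eval hfi⟩
  have hval : ∀ f : Ω n → ℝ, Measurable f → Integrable f (M.noise n : Measure (Ω n)) →
      ∀ᵐ ω ∂M.prob, ρ n (fun ω' => f (ω' n)) ω = T f := fun f hf hfi =>
    hfrozen (fun p => f p.2) (hf.comp measurable_snd) (integrable_eval hfi)
  have hcm : ∀ c : ℝ, MemZ (filt Ω n) M.prob fun _ => c := fun c =>
    ⟨measurable_const, integrable_const c⟩
  have hmul : ∀ f : Ω n → ℝ, Measurable f → Integrable f (M.noise n : Measure (Ω n)) →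
      ∀ c : ℝ, 0 ≤ c → T (fun x => c * f x) = c * T f := by
    intro f hf hfi c hc0
    obtain ⟨ω, h1, h2, h3⟩ := ((hval f hf hfi).and ((hval _ (hf.const_mul c)
      (hfi.const_mul c)).and (hc.homogeneous _ (fun _ => c) (hmem f hf hfi) (hcm c)
        (ae_of_all _ fun _ => hc0) (hmem _ (hf.const_mul c) (hfi.const_mul c))))).exists
    rw [← h1, ← h2, h3]
  refine ⟨T, ⟨?_, ?_, hmul, ?_, ?_⟩, hfrozen⟩
  · intro f g hf hfi hg hgi hfg
    have hfg' : ∀ᵐ ω ∂M.prob, f (ω n) ≤ g (ω n) := by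
      refine ae_of_ae_map (measurable_pi_apply n).aemeasurable (p := fun w => f w ≤ g w) ?_
      rw [prob, Measure.infinitePi_map_eval]
      exact hfg
    obtain ⟨ω, h1, h2, h3⟩ := ((hval f hf hfi).and ((hval g hg hgi).and
      (hc.mono _ _ (hmem f hf hfi) (hmem g hg hgi) hfg'))).exists
    rw [← h1, ← h2]
    exact h3
  · intro f g hf hfi hg hgi
    -- Subadditivity follows from convexity at the midpoint of `2 f` and `2 g`.
    have h2f := hmem _ (hf.const_mul 2) (hfi.const_mul 2)
    have h2g := hmem _ (hg.const_mul 2) (hgi.const_mul 2)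
    obtain ⟨ω, h1, h2, h3, h4⟩ := ((hval _ (hf.const_mul 2) (hfi.const_mul 2)).and
      ((hval _ (hg.const_mul 2) (hgi.const_mul 2)).and ((hval _ (hf.add hg) (hfi.add hgi)).and
      (hc.convex _ _ h2f h2g (1 / 2) (by norm_num) (by norm_num))))).exists
    rw [h1, h2, hmul f hf hfi 2 (by norm_num), hmul g hg hgi 2 (by norm_num)] at h4
    have h5 : (fun ω' : ∀ i, Ω i => 1 / 2 * (2 * f (ω' n)) + (1 - 1 / 2) * (2 * g (ω' n))) =
        fun ω' => (f + g) (ω' n) := by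
      funext ω'
      simp only [Pi.add_apply]
      ring
    rw [h5, h3] at h4
    calc T (fun x => f x + g x) = T (f + g) := rfl
      _ ≤ _ := h4
      _ = T f + T g := by ring
  · -- By translation equivariance, `ρ (0 + 1) = ρ 0 + 1`, and `ρ 0 = 0` by homogeneity.
    have hm0 : Measurable fun _ : Ω n => (0 : ℝ) := measurable_const
    have hi0 : Integrable (fun _ : Ω n => (0 : ℝ)) (M.noise n : Measure (Ω n)) :=
      integrable_const _
    have hT0 : T (fun _ => 0) = 0 := by simpa using hmul _ hm0 hi0 0 le_rfl
    obtain ⟨ω, h1, h2, h3⟩ := ((hval _ hm0 hi0).and ((hval _ (measurable_const (a := (1 : ℝ)))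
      (integrable_const _)).and (hc.translation _ _ (hmem _ hm0 hi0) (hcm 1)))).exists
    simp only [zero_add] at h3
    rw [← h2, h3, h1, hT0, zero_add]
  · intro f g _ _ _ _ hlaw
    simp only [T, hlaw]

/-- The frozen risk functional also represents the extension to functions with values in
`[0, ∞]`. Here the history enters through an observable `Y`. -/
theorem IsFrozenRisk.extend_eq {n : ℕ} {ρ : ((∀ i, Ω i) → ℝ) → ((∀ i, Ω i) → ℝ)}
    {T : (Ω n → ℝ) → ℝ} (h : M.IsFrozenRisk n ρ T) {𝓨 : Type*} [MeasurableSpace 𝓨]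
    [StandardBorelSpace 𝓨] {Y : (∀ i, Ω i) → 𝓨} (hY : Measurable[filt Ω n] Y)
    {g : 𝓨 × Ω n → ℝ≥0∞} (hg : Measurable g) :
    ∀ᵐ ω ∂M.prob, extend ρ (fun ω' => g (Y ω', ω' n)) ω =
      extendRisk T fun w => g (Y ω, w) := by
  have : Nonempty (∀ i, Ω i) := nonempty_of_isProbabilityMeasure M.prob
  have : Nonempty 𝓨 := this.map Y
  obtain ⟨y, hy, rfl⟩ := hY.exists_eq_measurable_comp
  have hg' : Measurable fun p : (∀ i : Set.Iio n, Ω i) × Ω n => g (y p.1, p.2) :=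
    hg.comp ((hy.comp measurable_fst).prodMk measurable_snd)
  have hpair : Measurable fun ω : ∀ i, Ω i => (hist Ω n ω, ω n) :=
    (measurable_hist n).prodMk (measurable_pi_apply n)
  have key : ∀ k, ∀ᵐ ω ∂M.prob, ρ (trunc (fun ω' => g ((y ∘ hist Ω n) ω', ω' n)) k) ω =
      T (trunc (fun w => g ((y ∘ hist Ω n) ω, w)) k) := fun k =>
    h (trunc (fun p => g (y p.1, p.2)) k) (measurable_trunc hg' k)
      (integrable_trunc (hg'.comp hpair) k)
  filter_upwards [ae_all_iff.2 key] with ω hω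
  exact iSup_congr fun k => congrArg ENNReal.ofReal (hω k)

end ControlModel

namespace ControlModel

variable {X A S Ω : ℕ → Type*}
  [∀ n, TopologicalSpace (X n)] [∀ n, TopologicalSpace (A n)]
  [∀ n, TopologicalSpace (S n)] [∀ n, MeasurableSpace (S n)] [∀ n, MeasurableSpace (Ω n)]
  {M : ControlModel X A S Ω}

/-- If almost surely `(Y, w) ∈ D` for almost every realization `w` of the noise at time `n`, where
`Y` is known at time `n`, then almost surely `(Y, ω n) ∈ D`. -/
theorem ae_of_ae_ae_noise {n : ℕ} {𝓨 : Type*} [MeasurableSpace 𝓨] [StandardBorelSpace 𝓨]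
    {Y : (∀ i, Ω i) → 𝓨} (hY : Measurable[filt Ω n] Y) {D : Set (𝓨 × Ω n)} (hD : MeasurableSet D)
    (h : ∀ᵐ ω ∂M.prob, ∀ᵐ w ∂(M.noise n : Measure (Ω n)), (Y ω, w) ∈ D) :
    ∀ᵐ ω ∂M.prob, (Y ω, ω n) ∈ D := by
  have : Nonempty (∀ i, Ω i) := nonempty_of_isProbabilityMeasure M.prob
  have : Nonempty 𝓨 := this.map Y
  obtain ⟨y, hy, rfl⟩ := hY.exists_eq_measurable_comp
  have hpair : Measurable fun ω : ∀ i, Ω i => (hist Ω n ω, ω n) :=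
    (measurable_hist n).prodMk (measurable_pi_apply n)
  have hD' : MeasurableSet {p : (∀ i : Set.Iio n, Ω i) × Ω n | (y p.1, p.2) ∈ D} :=
    ((hy.comp measurable_fst).prodMk measurable_snd) hD
  have : IsProbabilityMeasure (M.prob.map (hist Ω n)) :=
    Measure.isProbabilityMeasure_map (measurable_hist n).aemeasurable
  have hslice : MeasurableSet
      {q : ∀ i : Set.Iio n, Ω i | ∀ᵐ w ∂(M.noise n : Measure (Ω n)), (y q, w) ∈ D} :=
    ((measurable_measure_prodMk_left hD.compl).comp hy) (measurableSet_singleton 0)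
  have h1 : ∀ᵐ q ∂(M.prob.map (hist Ω n)), ∀ᵐ w ∂(M.noise n : Measure (Ω n)), (y q, w) ∈ D :=
    (ae_map_iff (measurable_hist n).aemeasurable hslice).2 h
  have h2 : ∀ᵐ p ∂(M.prob.map (hist Ω n)).prod (M.noise n : Measure (Ω n)), (y p.1, p.2) ∈ D :=
    (Measure.ae_prod_iff_ae_ae hD').2 h1
  rw [← M.map_hist_eval] at h2
  exact ae_of_ae_map hpair.aemeasurable h2

/-! ### The one-step cost operator -/

/-- The cost of the feasible pair `p` at time `n` and the discounted risk of the continuation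
value `u`, for the static risk functionals `T`. -/
noncomputable def stepValue (M : ControlModel X A S Ω) (T : ∀ n, (Ω n → ℝ) → ℝ) (γ : ℝ≥0) (n : ℕ)
    (u : X (n + 1) → ℝ≥0∞) (p : Graph (M.adm n)) : ℝ≥0∞ :=
  M.c n p + γ * extendRisk (T n) fun w => u (M.F n (p, M.ξ n w))

set_option linter.unusedSectionVars false

variable {T : ∀ n, (Ω n → ℝ) → ℝ} {γ : ℝ≥0}

variable [∀ n, PolishSpace (X n)] [∀ n, MeasurableSpace (X n)] [∀ n, BorelSpace (X n)]
  [∀ n, PolishSpace (A n)] [∀ n, MeasurableSpace (A n)] [∀ n, BorelSpace (A n)]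
  [∀ n, TopologicalSpace.MetrizableSpace (S n)] [∀ n, SecondCountableTopology (S n)]
  [∀ n, BorelSpace (S n)]

theorem measurable_F (n : ℕ) : Measurable (M.F n) := (M.continuous_F n).measurable

theorem measurable_next (n : ℕ) (p : Graph (M.adm n)) : Measurable fun w => M.F n (p, M.ξ n w) :=
  (measurable_F n).comp (measurable_const.prodMk (M.measurable_ξ n))

theorem Policy.measurable_pair (π : M.Policy) (n : ℕ) : Measurable (π.pair n) :=
  (measurable_id.prodMk (π.measurable_rule n)).subtype_mk

theorem Policy.measurable_next (π : M.Policy) (n : ℕ) :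
    Measurable fun p : X n × S n => M.F n (π.pair n p.1, p.2) :=
  (measurable_F n).comp (((π.measurable_pair n).comp measurable_fst).prodMk measurable_snd)

section StepValue

variable (hT : ∀ n, IsCoherentRisk (M.noise n : Measure (Ω n)) (T n))
include hT

theorem stepValue_mono {n : ℕ} {u v : X (n + 1) → ℝ≥0∞} (hu : Measurable u) (hv : Measurable v)
    (h : u ≤ v) (p : Graph (M.adm n)) : M.stepValue T γ n u p ≤ M.stepValue T γ n v p := by
  unfold stepValue
  gcongr
  exact (hT n).extendRisk_mono (hu.comp (measurable_next n p)) (hv.comp (measurable_next n p))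
    (ae_of_all _ fun w => h _)

theorem stepValue_zero {n : ℕ} (p : Graph (M.adm n)) : M.stepValue T γ n 0 p = M.c n p := by
  have h : ∀ k, trunc (fun _ : Ω n => (0 : ℝ≥0∞)) k = fun _ => 0 := fun k => by
    funext x; simp [trunc]
  simp [stepValue, extendRisk, h, (hT n).zero]

theorem stepValue_iSup {n : ℕ} {u : ℕ → X (n + 1) → ℝ≥0∞} (hu : ∀ k, Measurable (u k))
    (hmono : Monotone u) (p : Graph (M.adm n)) :
    M.stepValue T γ n (fun y => ⨆ k, u k y) p = ⨆ k, M.stepValue T γ n (u k) p := by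
  unfold stepValue
  rw [(hT n).extendRisk_iSup (g := fun k w => u k (M.F n (p, M.ξ n w)))
    (fun k => (hu k).comp (measurable_next n p)) (fun i j hij w => hmono hij _),
    ENNReal.mul_iSup, ENNReal.add_iSup]

/-- By Fatou's lemma for the risk functional, the one-step cost is lower semicontinuous when the
continuation value is. -/
theorem lowerSemicontinuous_stepValue (hM : M.IsSemicontinuousCompact) {n : ℕ}
    {u : X (n + 1) → ℝ≥0∞} (hu : LowerSemicontinuous u) :
    LowerSemicontinuous (M.stepValue T γ n u) := by
  have hc : LowerSemicontinuous fun p => (M.c n p : ℝ≥0∞) :=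
    ENNReal.continuous_coe.comp_lowerSemicontinuous (hM.lsc_cost n) ENNReal.coe_mono
  have hr : LowerSemicontinuous fun p => extendRisk (T n) fun w => u (M.F n (p, M.ξ n w)) := by
    intro p t ht
    by_contra hcon
    have : FirstCountableTopology (Graph (M.adm n)) :=
      Topology.IsInducing.subtypeVal.firstCountableTopology
    obtain ⟨q, hq, hqt⟩ := exists_seq_forall_of_frequently (not_eventually.1 hcon)
    have hfatou := (hT n).extendRisk_le_liminf (g := fun i w => u (M.F n (q i, M.ξ n w)))
      (fun i => hu.measurable.comp (measurable_next n (q i)))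
      (hu.measurable.comp (measurable_next n p)) (fun w => ?_)
    · have hle : liminf (fun i => extendRisk (T n) fun w => u (M.F n (q i, M.ξ n w))) atTop ≤ t :=
        liminf_le_of_le (by isBoundedDefault) fun b hb => by
          obtain ⟨i, hi⟩ := hb.exists
          exact hi.trans (not_lt.1 (hqt i))
      exact absurd ht (not_lt.2 (hfatou.trans hle))
    · have hlim : Tendsto (fun i => M.F n (q i, M.ξ n w)) atTop (𝓝 (M.F n (p, M.ξ n w))) :=
        ((M.continuous_F n).tendsto _).comp (hq.prodMk_nhds tendsto_const_nhds)
      refine le_of_forall_lt fun s hs => ?_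
      obtain ⟨s', hss', hs'⟩ := exists_between hs
      refine hss'.trans_le (le_liminf_of_le (by isBoundedDefault) ?_)
      exact (hlim.eventually (hu _ s' hs')).mono fun i hi => hi.le
  have hγ : LowerSemicontinuous fun p =>
      (γ : ℝ≥0∞) * extendRisk (T n) fun w => u (M.F n (p, M.ξ n w)) :=
    (ENNReal.continuous_const_mul ENNReal.coe_ne_top).comp_lowerSemicontinuous hr
      fun a b hab => mul_le_mul_right hab _
  exact hc.add hγ

end StepValue

variable [∀ n, StandardBorelSpace (S n)] {ρ : ℕ → ((∀ i, Ω i) → ℝ) → ((∀ i, Ω i) → ℝ)}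

/-! ### The costs of a policy as functions of the state -/

/-- The cost of the policy `π` over `k` stages from time `n` on, as a function of the state at time
`n`. -/
noncomputable def policyCost (T : ∀ n, (Ω n → ℝ) → ℝ) (γ : ℝ≥0) (π : M.Policy) :
    (k n : ℕ) → X n → ℝ≥0∞
  | 0, _, _ => 0
  | k + 1, n, x => M.stepValue T γ n (policyCost T γ π k (n + 1)) (π.pair n x)

section PolicyCost

variable (hT : ∀ n, IsCoherentRisk (M.noise n : Measure (Ω n)) (T n))
include hT

theorem measurable_policyCost (hM : M.IsSemicontinuousCompact) (π : M.Policy) (k n : ℕ) :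
    Measurable (policyCost T γ π k n) := by
  induction k generalizing n with
  | zero => exact measurable_const
  | succ k ih =>
    exact ((hM.lsc_cost n).measurable.coe_nnreal_ennreal.comp (π.measurable_pair n)).add
      (((hT n).measurable_extendRisk (M.measurable_ξ n)
        ((ih (n + 1)).comp (π.measurable_next n))).const_mul _)

theorem policyCost_le_succ (hM : M.IsSemicontinuousCompact) (π : M.Policy) (k n : ℕ) :
    policyCost T γ π k n ≤ policyCost T γ π (k + 1) n := by
  induction k generalizing n with
  | zero => exact fun x => zero_le
  | succ k ih =>
    exact fun x => stepValue_mono hT (measurable_policyCost hT hM π _ _)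
      (measurable_policyCost hT hM π _ _) (ih (n + 1)) _

theorem policyCost_monotone (hM : M.IsSemicontinuousCompact) (π : M.Policy) (n : ℕ) :
    Monotone fun k => policyCost T γ π k n :=
  monotone_nat_of_le_succ fun k => policyCost_le_succ hT hM π k n

end PolicyCost

theorem measurable_state (π : M.Policy) {n : ℕ} (x : X n) (j : ℕ) :
    Measurable[filt Ω (n + j)] (M.state π x j) := by
  induction j with
  | zero => exact measurable_const
  | succ j ih =>
    have h1 : Measurable[filt Ω (n + j + 1)] (M.state π x j) :=
      ih.mono (filt_mono (n + j).le_succ) le_rfl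
    have h2 : Measurable[filt Ω (n + j + 1)] fun ω : ∀ i, Ω i => M.ξ (n + j) (ω (n + j)) :=
      (M.measurable_ξ (n + j)).comp (measurable_filt_eval (n + j).lt_succ_self)
    exact (π.measurable_next (n + j)).comp (h1.prodMk h2)

theorem measurable_stageCost (hM : M.IsSemicontinuousCompact) (π : M.Policy) {n : ℕ} (x : X n)
    (j : ℕ) : Measurable[filt Ω (n + j)] (M.stageCost π x j) :=
  ((hM.lsc_cost (n + j)).measurable.coe_nnreal_ennreal.comp (π.measurable_pair (n + j))).comp
    (measurable_state π x j)

theorem measurable_nestedCost (hρ : M.IsRiskSystem ρ) (hM : M.IsSemicontinuousCompact)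
    (π : M.Policy) {n : ℕ} (x : X n) (k j : ℕ) :
    Measurable[filt Ω (n + j)] (M.nestedCost γ ρ π x k j) := by
  induction k generalizing j with
  | zero => exact measurable_stageCost hM π x j
  | succ k ih =>
    exact (measurable_stageCost hM π x j).add
      (((hρ (n + j)).1.measurable_extend (filt_le _) (ih (j + 1))).const_mul _)

section Representation

variable (hρ : M.IsRiskSystem ρ)
  (hT : ∀ n, IsCoherentRisk (M.noise n : Measure (Ω n)) (T n))
  (hfr : ∀ n, M.IsFrozenRisk n (ρ n) (T n))
include hρ hT hfr

/-- The nested random costs are almost surely functions of the present state. -/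
theorem nestedCost_ae_eq (hM : M.IsSemicontinuousCompact) (π : M.Policy) {n : ℕ} (x : X n)
    (k j : ℕ) : ∀ᵐ ω ∂M.prob,
      M.nestedCost γ ρ π x k j ω = policyCost T γ π (k + 1) (n + j) (M.state π x j ω) := by
  induction k generalizing j with
  | zero =>
    refine ae_of_all _ fun ω => ?_
    exact (stepValue_zero hT (π.pair (n + j) (M.state π x j ω))).symm
  | succ k ih =>
    have hg : Measurable fun p : X (n + j) × Ω (n + j) =>
        policyCost T γ π (k + 1) (n + j + 1)
          (M.F (n + j) (π.pair (n + j) p.1, M.ξ (n + j) p.2)) :=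
      (measurable_policyCost hT hM π (k + 1) (n + j + 1)).comp ((π.measurable_next (n + j)).comp
        (measurable_fst.prodMk ((M.measurable_ξ (n + j)).comp measurable_snd)))
    have hmeas : Measurable[filt Ω (n + j + 1)] fun ω =>
        policyCost T γ π (k + 1) (n + j + 1) (M.state π x (j + 1) ω) :=
      (measurable_policyCost hT hM π (k + 1) (n + j + 1)).comp (measurable_state π x (j + 1))
    filter_upwards [(hρ (n + j)).1.extend_congr (filt_le _)
        (measurable_nestedCost hρ hM π x k (j + 1)) hmeas (ih (j + 1)),
      (hfr (n + j)).extend_eq (measurable_state π x j) hg] with ω h1 h2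
    exact congrArg (fun r => M.stageCost π x j ω + γ * r) (h1.trans h2)

theorem totalCost_ae_eq (hM : M.IsSemicontinuousCompact) (π : M.Policy) {n : ℕ} (x : X n)
    (j : ℕ) : ∀ᵐ ω ∂M.prob,
      M.totalCost γ ρ π x j ω = ⨆ k, policyCost T γ π k (n + j) (M.state π x j ω) ∧
      Tendsto (fun k => M.nestedCost γ ρ π x k j ω) atTop (𝓝 (M.totalCost γ ρ π x j ω)) := by
  filter_upwards [ae_all_iff.2 fun k => nestedCost_ae_eq (γ := γ) hρ hT hfr hM π x k j] with ω hω
  have hlim : Tendsto (fun k => M.nestedCost γ ρ π x k j ω) atTop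
      (𝓝 (⨆ k, policyCost T γ π k (n + j) (M.state π x j ω))) := by
    simp_rw [hω]
    exact (tendsto_atTop_iSup fun k k' hk => policyCost_monotone hT hM π (n + j) hk
      (M.state π x j ω)).comp (tendsto_add_atTop_nat 1)
  have heq : M.totalCost γ ρ π x j ω = _ := hlim.limsup_eq
  exact ⟨heq, heq ▸ hlim⟩

theorem value_eq (hM : M.IsSemicontinuousCompact) (π : M.Policy) {n : ℕ} (x : X n) (k : ℕ) :
    M.value γ ρ π x k = policyCost T γ π (k + 1) n x := by
  have h : M.nestedCost γ ρ π x k 0 =ᵐ[M.prob] fun _ => policyCost T γ π (k + 1) n x :=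
    nestedCost_ae_eq hρ hT hfr hM π x k 0
  exact (essSup_congr_ae h).trans (essSup_const' _)

theorem valueInf_eq (hM : M.IsSemicontinuousCompact) (π : M.Policy) {n : ℕ} (x : X n) :
    M.valueInf γ ρ π x = ⨆ k, policyCost T γ π k n x := by
  have h : M.totalCost γ ρ π x 0 =ᵐ[M.prob] fun _ => ⨆ k, policyCost T γ π k n x :=
    (totalCost_ae_eq hρ hT hfr hM π x 0).mono fun _ h => h.1
  exact (essSup_congr_ae h).trans (essSup_const' _)

end Representation

/-! ### Dynamic programming -/

/-- The limit of the optimal values with finite horizon, as computed by backward dynamic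
programming. -/
noncomputable def bellmanLimit (M : ControlModel X A S Ω) (γ : ℝ≥0)
    (ρ : ℕ → ((∀ i, Ω i) → ℝ) → ((∀ i, Ω i) → ℝ)) (n : ℕ) (x : X n) : ℝ≥0∞ :=
  ⨆ k, M.bellman γ ρ k n x

section Bellman

variable (hT : ∀ n, IsCoherentRisk (M.noise n : Measure (Ω n)) (T n))
  (hfr : ∀ n, M.IsFrozenRisk n (ρ n) (T n))
include hT hfr

theorem bellman_succ_eq {k n : ℕ} (hmeas : Measurable (M.bellman γ ρ k (n + 1))) (x : X n) :
    M.bellman γ ρ (k + 1) n x =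
      ⨅ a : M.adm n x, M.stepValue T γ n (M.bellman γ ρ k (n + 1)) ⟨(x, a), a.2⟩ := by
  rw [bellman]
  refine iInf_congr fun a => ?_
  have hnext : Measurable fun p : Unit × Ω n =>
      M.bellman γ ρ k (n + 1) (M.F n (⟨(x, a), a.2⟩, M.ξ n p.2)) :=
    hmeas.comp ((measurable_next n _).comp measurable_snd)
  rw [essSup_congr_ae ((hfr n).extend_eq (Y := fun _ => ()) measurable_const hnext),
    essSup_const' _]
  rfl

theorem lowerSemicontinuous_bellman (hM : M.IsSemicontinuousCompact) (k n : ℕ) :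
    LowerSemicontinuous (M.bellman γ ρ k n) := by
  induction k generalizing n with
  | zero => exact lowerSemicontinuous_const
  | succ k ih =>
    have h := lowerSemicontinuous_iInf_inter (hM.usc_adm n) (hM.isCompact_adm n)
      (lowerSemicontinuous_stepValue (γ := γ) hT hM (ih (n + 1))) isClosed_univ
    convert h using 2 with x
    rw [bellman_succ_eq hT hfr (ih (n + 1)).measurable]
    simp

theorem measurable_bellman (hM : M.IsSemicontinuousCompact) (k n : ℕ) :
    Measurable (M.bellman γ ρ k n) :=
  (lowerSemicontinuous_bellman hT hfr hM k n).measurable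

theorem bellman_le_succ (hM : M.IsSemicontinuousCompact) (k n : ℕ) :
    M.bellman γ ρ k n ≤ M.bellman γ ρ (k + 1) n := by
  induction k generalizing n with
  | zero => exact fun x => zero_le
  | succ k ih =>
    intro x
    have h1 := measurable_bellman (γ := γ) hT hfr hM k (n + 1)
    have h2 := measurable_bellman (γ := γ) hT hfr hM (k + 1) (n + 1)
    rw [bellman_succ_eq hT hfr h1, bellman_succ_eq hT hfr h2]
    exact iInf_mono fun a => stepValue_mono hT h1 h2 (ih (n + 1)) _

theorem bellman_monotone (hM : M.IsSemicontinuousCompact) (n : ℕ) :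
    Monotone fun k => M.bellman γ ρ k n :=
  monotone_nat_of_le_succ fun k => bellman_le_succ hT hfr hM k n

theorem lowerSemicontinuous_bellmanLimit (hM : M.IsSemicontinuousCompact) (n : ℕ) :
    LowerSemicontinuous (M.bellmanLimit γ ρ n) :=
  lowerSemicontinuous_iSup fun k => lowerSemicontinuous_bellman hT hfr hM k n

theorem bellman_le_policyCost (hM : M.IsSemicontinuousCompact) (π : M.Policy) (k n : ℕ) :
    M.bellman γ ρ k n ≤ policyCost T γ π k n := by
  induction k generalizing n with
  | zero => exact fun x => le_rfl
  | succ k ih =>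
    intro x
    have h1 := measurable_bellman (γ := γ) hT hfr hM k (n + 1)
    rw [bellman_succ_eq hT hfr h1]
    exact (iInf_le _ (⟨π.rule n x, π.mem_adm n x⟩ : M.adm n x)).trans
      (stepValue_mono hT h1 (measurable_policyCost hT hM π k (n + 1)) (ih (n + 1)) _)

/-- For every finite horizon there is an optimal policy. -/
theorem exists_policyCost_le_bellman (hM : M.IsSemicontinuousCompact) (N : ℕ) :
    ∃ π : M.Policy, ∀ k n, k + n = N → policyCost T γ π k n ≤ M.bellman γ ρ k n := by
  have hsel : ∀ k n, ∃ σ : X n → A n, Measurable σ ∧ ∀ x, ∃ ha : σ x ∈ M.adm n x,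
      M.stepValue T γ n (M.bellman γ ρ k (n + 1)) ⟨(x, σ x), ha⟩ ≤ M.bellman γ ρ (k + 1) n x := by
    intro k n
    have hlsc := lowerSemicontinuous_stepValue (γ := γ) hT hM
      (lowerSemicontinuous_bellman (γ := γ) hT hfr hM k (n + 1))
    refine exists_measurable_selector_le (hM.usc_adm n) (hM.isCompact_adm n) hlsc
      (measurable_bellman hT hfr hM (k + 1) n) fun x => ?_
    obtain ⟨a, -, ha⟩ := exists_isMin_inter (hM.isCompact_adm n) hlsc isClosed_univ (x := x)
      (by simpa using M.adm_nonempty n x)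
    refine ⟨a, ha.le.trans (le_of_eq ?_)⟩
    rw [bellman_succ_eq hT hfr (measurable_bellman hT hfr hM k (n + 1))]
    simp
  choose σ hσm hσ using hsel
  -- At time `n`, the number of stages that remain after the present one is `N - 1 - n`.
  refine ⟨⟨fun n => σ (N - 1 - n) n, fun n => hσm _ n, fun n x => (hσ _ n x).1⟩, ?_⟩
  intro k
  induction k with
  | zero => exact fun n _ x => le_rfl
  | succ k ih =>
    intro n hn x
    have hk : N - 1 - n = k := by omega
    obtain ⟨ha, hle⟩ := hσ k n x
    refine le_trans ?_ hle
    refine (stepValue_mono hT (measurable_policyCost hT hM _ k (n + 1))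
      (measurable_bellman hT hfr hM k (n + 1)) (ih (n + 1) (by omega)) _).trans (le_of_eq ?_)
    simp only [Policy.pair, hk]

/-- The limit of the finite horizon values satisfies the optimality inequality along a suitable
policy, since minimization over compact sets commutes with increasing limits. -/
theorem exists_stepValue_le_bellmanLimit (hM : M.IsSemicontinuousCompact) :
    ∃ π : M.Policy, ∀ n x,
      M.stepValue T γ n (M.bellmanLimit γ ρ (n + 1)) (π.pair n x) ≤ M.bellmanLimit γ ρ n x := by
  have hsel : ∀ n, ∃ σ : X n → A n, Measurable σ ∧ ∀ x, ∃ ha : σ x ∈ M.adm n x,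
      M.stepValue T γ n (M.bellmanLimit γ ρ (n + 1)) ⟨(x, σ x), ha⟩ ≤ M.bellmanLimit γ ρ n x := by
    intro n
    refine exists_measurable_selector_le (hM.usc_adm n) (hM.isCompact_adm n)
      (lowerSemicontinuous_stepValue hT hM (lowerSemicontinuous_bellmanLimit hT hfr hM (n + 1)))
      (lowerSemicontinuous_bellmanLimit hT hfr hM n).measurable fun x => ?_
    have : CompactSpace (M.adm n x) := isCompact_iff_compactSpace.1 (hM.isCompact_adm n x)
    have : Nonempty (M.adm n x) := (M.adm_nonempty n x).to_subtype
    have hmeas := fun k => measurable_bellman (γ := γ) hT hfr hM k (n + 1)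
    obtain ⟨a, ha⟩ := exists_forall_le_iSup_iInf
      (h := fun k (a : M.adm n x) =>
        M.stepValue T γ n (M.bellman γ ρ k (n + 1)) ⟨(x, a), a.2⟩)
      (fun k => lowerSemicontinuous_section (lowerSemicontinuous_stepValue hT hM
        (lowerSemicontinuous_bellman hT hfr hM k (n + 1))) x)
      (fun k k' hk a => stepValue_mono hT (hmeas k) (hmeas k')
        (bellman_monotone hT hfr hM (n + 1) hk) _)
    refine ⟨a, ?_⟩
    have h := stepValue_iSup (γ := γ) hT hmeas (bellman_monotone hT hfr hM (n + 1))
      ⟨(x, a), a.2⟩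
    refine (le_of_eq h).trans (iSup_le fun k => (ha k).trans (iSup_le fun k' => ?_))
    rw [← bellman_succ_eq hT hfr (hmeas k')]
    exact le_iSup (fun k => M.bellman γ ρ k n x) (k' + 1)
  choose σ hσm hσ using hsel
  exact ⟨⟨σ, hσm, fun n x => (hσ n x).1⟩, fun n x => (hσ n x).2⟩

section Conserving

variable (hM : M.IsSemicontinuousCompact) {π : M.Policy} (hπ : ∀ n x,
  M.stepValue T γ n (M.bellmanLimit γ ρ (n + 1)) (π.pair n x) ≤ M.bellmanLimit γ ρ n x)
include hM hπ

theorem policyCost_le_bellmanLimit (k n : ℕ) :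
    policyCost T γ π k n ≤ M.bellmanLimit γ ρ n := by
  induction k generalizing n with
  | zero => exact fun x => zero_le
  | succ k ih =>
    exact fun x => (stepValue_mono hT (measurable_policyCost hT hM π k (n + 1))
      (lowerSemicontinuous_bellmanLimit hT hfr hM (n + 1)).measurable (ih (n + 1)) _).trans (hπ n x)

/-- Along the policy `π`, the finiteness of `bellmanLimit` is inherited by the later states: on
atomless spaces, an infinite value with positive probability has infinite risk. -/
theorem bellmanLimit_state_lt_top (hγ : 0 < γ) {n : ℕ} {x : X n}
    (hx : M.bellmanLimit γ ρ n x < ∞) (j : ℕ) :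
    ∀ᵐ ω ∂M.prob, M.bellmanLimit γ ρ (n + j) (M.state π x j ω) < ∞ := by
  induction j with
  | zero => exact ae_of_all _ fun _ => hx
  | succ j ih =>
    have hmeas := (lowerSemicontinuous_bellmanLimit (γ := γ) hT hfr hM (n + j + 1)).measurable
    have hD : MeasurableSet {p : X (n + j) × Ω (n + j) | M.bellmanLimit γ ρ (n + j + 1)
        (M.F (n + j) (π.pair (n + j) p.1, M.ξ (n + j) p.2)) < ∞} :=
      (hmeas.comp ((π.measurable_next (n + j)).comp (measurable_fst.prodMk
        ((M.measurable_ξ (n + j)).comp measurable_snd)))) measurableSet_Iio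
    refine ae_of_ae_ae_noise (measurable_state π x j) hD ?_
    filter_upwards [ih] with ω hω
    refine (hT (n + j)).ae_lt_top_of_extendRisk (M.noise_atomless (n + j))
      (hmeas.comp (measurable_next (n + j) (π.pair (n + j) (M.state π x j ω)))) ?_
    have h1 := (le_add_self.trans (hπ (n + j) (M.state π x j ω))).trans_lt hω
    exact ENNReal.lt_top_of_mul_ne_top_right h1.ne (by simpa using hγ.ne')

theorem mem_admissible (hρ : M.IsRiskSystem ρ) (hγ : 0 < γ) {n : ℕ} {x : X n}
    (hx : M.bellmanLimit γ ρ n x < ∞) : π ∈ M.admissible γ ρ x := by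
  intro j
  filter_upwards [totalCost_ae_eq (γ := γ) hρ hT hfr hM π x j,
    bellmanLimit_state_lt_top hT hfr hM hπ hγ hx j] with ω h1 h2
  rw [h1.1]
  exact (iSup_le fun k => policyCost_le_bellmanLimit hT hfr hM hπ k (n + j) _).trans_lt h2

end Conserving

theorem optValueInf_eq (hM : M.IsSemicontinuousCompact) (hρ : M.IsRiskSystem ρ) (hγ : 0 < γ)
    (n : ℕ) : M.optValueInf γ ρ n = M.bellmanLimit γ ρ n := by
  funext x
  refine le_antisymm ?_ (le_iInf₂ fun π _ => ?_)
  · rcases eq_top_or_lt_top (M.bellmanLimit γ ρ n x) with htop | hx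
    · rw [htop]
      exact le_top
    · obtain ⟨π, hπ⟩ := exists_stepValue_le_bellmanLimit (γ := γ) hT hfr hM
      refine (iInf₂_le π (mem_admissible hT hfr hM hπ hρ hγ hx)).trans ?_
      rw [valueInf_eq hρ hT hfr hM]
      exact iSup_le fun k => policyCost_le_bellmanLimit hT hfr hM hπ k n x
  · rw [valueInf_eq hρ hT hfr hM]
    exact iSup_mono fun k => bellman_le_policyCost hT hfr hM π k n x

end Bellman

end ControlModel

end RiskControl

theorem theorem4p6 {X A S Ω : ℕ → Type*}
    [∀ n, TopologicalSpace (X n)] [∀ n, PolishSpace (X n)]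
    [∀ n, MeasurableSpace (X n)] [∀ n, BorelSpace (X n)]
    [∀ n, TopologicalSpace (A n)] [∀ n, PolishSpace (A n)]
    [∀ n, MeasurableSpace (A n)] [∀ n, BorelSpace (A n)]
    [∀ n, TopologicalSpace (S n)] [∀ n, TopologicalSpace.MetrizableSpace (S n)]
    [∀ n, SecondCountableTopology (S n)]
    [∀ n, MeasurableSpace (S n)] [∀ n, BorelSpace (S n)] [∀ n, StandardBorelSpace (S n)]
    [∀ n, MeasurableSpace (Ω n)]
    (M : RiskControl.ControlModel X A S Ω)
    (γ : ℝ≥0) (hγ : 0 < γ)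
    (ρ : ℕ → ((∀ i, Ω i) → ℝ) → ((∀ i, Ω i) → ℝ)) (hρ : M.IsRiskSystem ρ)
    (hQ : M.IsWeaklyContinuous) (hM : M.IsSemicontinuousCompact) (n : ℕ) :
    (∀ x : X n,
      -- the costs of every policy from time `n` on are almost surely constants, and they converge
      (∀ π : M.Policy, ∀ᵐ ω ∂M.prob,
        (∀ k, M.nestedCost γ ρ π x k 0 ω = M.value γ ρ π x k) ∧
        M.totalCost γ ρ π x 0 ω = M.valueInf γ ρ π x ∧
        Tendsto (fun k => M.nestedCost γ ρ π x k 0 ω) atTop (𝓝 (M.totalCost γ ρ π x 0 ω))) ∧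
      -- backward dynamic programming computes the optimal values with finite horizon
      (∀ k, M.bellman γ ρ (k + 1) n x = ⨅ π : M.Policy, M.value γ ρ π x k) ∧
      -- these values increase to the optimal value with infinite horizon
      Monotone (fun k => M.bellman γ ρ (k + 1) n x) ∧
      Tendsto (fun k => M.bellman γ ρ (k + 1) n x) atTop (𝓝 (M.optValueInf γ ρ n x)) ∧
      -- and so do the infima over the admissible policies
      Monotone (fun k => M.optValue γ ρ n k x) ∧
      Tendsto (fun k => M.optValue γ ρ n k x) atTop (𝓝 (M.optValueInf γ ρ n x))) ∧
    LowerSemicontinuous (M.optValueInf γ ρ n) := by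
  open RiskControl ControlModel in
  choose T hT hfr using fun n => exists_frozenRisk hρ n
  have hlim := optValueInf_eq hT hfr hM hρ hγ n
  have hmono : ∀ x, Monotone fun k => M.bellman γ ρ k n x := fun x k k' hk =>
    bellman_monotone hT hfr hM n hk x
  refine ⟨fun x => ?_, hlim ▸ lowerSemicontinuous_bellmanLimit hT hfr hM n⟩
  have hJ : Tendsto (fun k => M.bellman γ ρ (k + 1) n x) atTop (𝓝 (M.optValueInf γ ρ n x)) := by
    rw [hlim]
    exact (tendsto_atTop_iSup (hmono x)).comp (tendsto_add_atTop_nat 1)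
  refine ⟨fun π => ?_, fun k => ?_, fun k k' hk => hmono x (by omega), hJ, fun k k' hk => ?_, ?_⟩
  · filter_upwards [ae_all_iff.2 fun k => nestedCost_ae_eq (γ := γ) hρ hT hfr hM π x k 0,
      totalCost_ae_eq (γ := γ) hρ hT hfr hM π x 0] with ω h1 h2
    refine ⟨fun k => ?_, ?_, h2.2⟩
    · rw [h1, value_eq hρ hT hfr hM]
      rfl
    · rw [h2.1, valueInf_eq hρ hT hfr hM]
      rfl
  · refine le_antisymm (le_iInf fun π => ?_) ?_
    · rw [value_eq hρ hT hfr hM]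
      exact bellman_le_policyCost hT hfr hM π (k + 1) n x
    · obtain ⟨π, hπ⟩ := exists_policyCost_le_bellman (γ := γ) hT hfr hM (k + 1 + n)
      refine (iInf_le _ π).trans ?_
      rw [value_eq hρ hT hfr hM]
      exact hπ (k + 1) n rfl x
  · refine iInf₂_mono fun π _ => ?_
    rw [value_eq hρ hT hfr hM, value_eq hρ hT hfr hM]
    exact policyCost_monotone hT hM π n (Nat.succ_le_succ hk) x
  · refine tendsto_of_tendsto_of_tendsto_of_le_of_le hJ tendsto_const_nhds (fun k => ?_)
      fun k => ?_
    · refine le_iInf₂ fun π _ => ?_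
      rw [value_eq hρ hT hfr hM]
      exact bellman_le_policyCost hT hfr hM π (k + 1) n x
    · refine iInf₂_mono fun π _ => ?_
      rw [value_eq hρ hT hfr hM, valueInf_eq hρ hT hfr hM]
      exact le_iSup (fun k => policyCost T γ π k n x) (k + 1)
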